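/- **Setting.** Let $d\ge 1$, let $e_0,\dots,e_{d-1}$ be the canonical basis of $\mathbb C^d$ and $\Psi_j$, $j\in\mathbb Z$, that of $\ell^2(\mathbb Z)$. Let $a_j^{*},a_j$ and $b_j^{*},b_j$ be the fermionic creation and annihilation operators on the antisymmetric Fock spaces $\mathcal F_-(\mathbb C^d)$ (the sample) and $\mathcal F_-(\ell^2(\mathbb Z))$ (the reservoir), let $\mathcal B$ be the $C^*$-algebra generated by the $b_j$, and let $S\Psi_j=\Psi_{j-1}$. For a unitary $d\times d$ matrix $W$ and $\alpha\in\mathbb R$ put, on $\mathcal F_-(\ell^2(\mathbb Z))\otimes\mathcal F_-(\mathbb C^d)$, $$U=(\Gamma(S)\otimes\Gamma(W))\,K,\qquad K=\exp\big[-i\alpha\,(b_0^*\otimes a_0+b_0\otimes a_0^*)\big],\qquad \tau^t(X)=U^{*t}XU^t ,$$ where $\Gamma$ is second quantization. Let $0\le\sigma\le 1$ and let $\omega$ be the gauge-invariant quasi-free state on $\mathcal B$ with symbol $\sigma\mathbb I$, i.e. $\omega(b^*(\varphi_m)\cdots b^*(\varphi_1)b(\psi_1)\cdots b(\psi_n))=\delta_{nm}\det\{\sigma\langle\psi_j|\varphi_k\rangle\}$.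 For a density matrix $\rho$ on $\mathcal F_-(\mathbb C^d)$ put $\rho_t(A)=(\omega\otimes\rho)(\tau^t(\mathbb I\otimes A))$, $t\in\mathbb N$, and let the $p$-body reduced density matrix $\rho^{(p)}_t$ on $(\mathbb C^d)^{\wedge p}$ be given by $$\langle e_{j_1}\wedge\dots\wedge e_{j_p}|\rho_t^{(p)}\,e_{k_1}\wedge\dots\wedge e_{k_p}\rangle=\rho_t(a_{k_1}^*\cdots a_{k_p}^*a_{j_p}\cdots a_{j_1}).$$ Let $n_j=a_j^*a_j$. We say that $W$ *thermalizes* if for every density matrix $\rho$, as $t\to\infty$, $$\rho_t^{(1)}\to\sigma\,\mathbb I_{\mathbb C^d},\qquad \rho_t^{(2)}\to\sigma^2\,\mathbb I_{(\mathbb C^d)^{\wedge 2}},\qquad \rho_t(n_j)\to\sigma\ \ \text{for all } j,\qquad \rho_t(n_jn_k)\to\sigma^2\ \ \text{for all } j\ne k .$$ **Coined walks.** For $C=(C_x)_{0\le x<n}\in U(2)^n$, $n\ge1$, $C_x=\begin{pmatrix}\alpha_x&\beta_x\\ \gamma_x&\delta_x\end{pmatrix}$, the walk with periodic boundary conditions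 is $$V(C)=\sum_{x}\big(P_{+1}C_x\otimes|x+1\rangle\langle x|+P_{-1}C_x\otimes|x-1\rangle\langle x|\big)\quad\text{on }\mathbb C^2\otimes\ell^2(\mathbb Z/n),$$ where $P_{\pm1}=|\pm1\rangle\langle\pm1|$. It is identified with a unitary matrix $W$ on $\mathbb C^{2n}$ through the ordered basis $|{+1}\otimes 0\rangle,|{-1}\otimes 0\rangle,|{+1}\otimes 1\rangle,\dots,|{-1}\otimes (n-1)\rangle$, denoted $e_0,\dots,e_{2n-1}$. For $n\ge 2$ and $C_0=C_{n-1}=\begin{pmatrix}0&1\\1&0\end{pmatrix}$, the walk with Dirichlet boundary conditions is the restriction of $V(C)$ to the orthogonal complement of the invariant subspace spanned by $|{+1}\otimes 0\rangle$ and $|{-1}\otimes (n-1)\rangle$, identified with a matrix $W$ on $\mathbb C^{2(n-1)}$ through the ordered basis $|{-1}\otimes 0\rangle,|{+1}\otimes 1\rangle,|{-1}\otimes 1\rangle,\dots,|{-1}\otimes (n-2)\rangle,|{+1}\otimes (n-1)\rangle$, denoted $e_0,\dots,e_{2n-3}$. **Statement.** Let $\cos\alpha\notin\{1,-1\}$ and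 $0\le\sigma\le1$. 1. (Periodic boundary conditions.) For every $n\ge 1$ the walk $W$ thermalizes whenever $e_0$ is cyclic for $W$, i.e. the vectors $W^ke_0$, $k\in\mathbb N$, span $\mathbb C^{2n}$. This holds for generic coins: the set of $C\in U(2)^n$ for which $e_0$ is cyclic is open and dense, and its complement has Haar measure zero. 2. (Dirichlet boundary conditions.) For every $n\ge2$ the walk $W$ thermalizes for all coins $C_1,\dots,C_{n-2}\in U(2)$ with $0<|\alpha_x\beta_x|$ for all $x\in\{1,\dots,n-2\}$. -/

import Mathlib

open scoped Matrix Kronecker Topology ComplexOrder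
open Filter

noncomputable section

namespace FermiWalk

/-! ### The fermionic Fock spaces

For a linearly ordered index set `ι` the vector `e_I`, with `I = {i₁ < ... < iₚ}` a finite subset
of `ι`, is `e_{i₁} ∧ ... ∧ e_{iₚ}`; these vectors form an orthonormal basis of the antisymmetric
Fock space over `ℓ²(ι)`.  In this basis `c_j^* e_I = e_j ∧ e_I = (-1)^{#{i ∈ I : i < j}} e_{I ∪ {j}}`
if `j ∉ I`, and `c_j^* e_I = 0` otherwise. -/

/-- The sign `(-1)^{#{i ∈ I : i < j}}`. -/
def fermiSign {ι : Type*} [LinearOrder ι] (j : ι) (I : Finset ι) : ℂ :=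
  (-1) ^ (I.filter (fun i => i < j)).card

/-- The antisymmetric Fock space of the reservoir, over `ℓ²(ℤ)`. -/
abbrev ResFock : Type := lp (fun _ : Finset ℤ => ℂ) 2

theorem pullback_bound (c : Finset ℤ → ℂ) (g : Finset ℤ → Finset ℤ) (hc : ∀ I, ‖c I‖ ≤ 1)
    (hg : Set.InjOn g {I | c I ≠ 0}) (f : ResFock) (s : Finset (Finset ℤ)) :
    ∑ I ∈ s, ‖c I * f (g I)‖ ^ (2 : ENNReal).toReal ≤ ‖f‖ ^ (2 : ENNReal).toReal := by
  classical
  have h2 : (0 : ℝ) < (2 : ENNReal).toReal := by norm_num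
  calc ∑ I ∈ s, ‖c I * f (g I)‖ ^ (2 : ENNReal).toReal
      = ∑ I ∈ s.filter (fun I => c I ≠ 0), ‖c I * f (g I)‖ ^ (2 : ENNReal).toReal := by
        refine (Finset.sum_filter_of_ne ?_).symm
        intro I _ h h0
        apply h
        rw [h0, zero_mul, norm_zero, Real.zero_rpow h2.ne']
    _ ≤ ∑ I ∈ s.filter (fun I => c I ≠ 0), ‖f (g I)‖ ^ (2 : ENNReal).toReal := by
        refine Finset.sum_le_sum fun I _ => ?_
        refine Real.rpow_le_rpow (norm_nonneg _) ?_ h2.le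
        rw [norm_mul]
        exact mul_le_of_le_one_left (norm_nonneg _) (hc I)
    _ = ∑ J ∈ (s.filter (fun I => c I ≠ 0)).image g, ‖f J‖ ^ (2 : ENNReal).toReal := by
        rw [Finset.sum_image]
        intro I hI J hJ h
        exact hg (by simpa using (Finset.mem_filter.1 hI).2)
          (by simpa using (Finset.mem_filter.1 hJ).2) h
    _ ≤ ‖f‖ ^ (2 : ENNReal).toReal := lp.sum_rpow_le_norm_rpow h2 f _

/-- The bounded operator `(T f)(I) = c(I) f(g(I))`, where `|c| ≤ 1` and `g` is injective on the
support of `c`. -/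
def pullback (c : Finset ℤ → ℂ) (g : Finset ℤ → Finset ℤ) (hc : ∀ I, ‖c I‖ ≤ 1)
    (hg : Set.InjOn g {I | c I ≠ 0}) : ResFock →L[ℂ] ResFock :=
  LinearMap.mkContinuous
    { toFun := fun f => ⟨fun I => c I * f (g I), memℓp_gen' (pullback_bound c g hc hg f)⟩
      map_add' := fun f h => by
        ext I
        exact mul_add _ _ _
      map_smul' := fun a f => by
        ext I
        exact mul_left_comm _ _ _ }
    1 fun f => by
      rw [one_mul]
      exact lp.norm_le_of_forall_sum_le (by norm_num) (norm_nonneg f)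
        (pullback_bound c g hc hg f)

/-- The annihilation operator `b_j` of the reservoir:
`⟨e_I, b_j f⟩ = (-1)^{#{i ∈ I : i < j}} ⟨e_{I ∪ {j}}, f⟩` if `j ∉ I`, and `0` if `j ∈ I`.
Its adjoint `star (resAnn j)` is the creation operator `b_j^*`. -/
def resAnn (j : ℤ) : ResFock →L[ℂ] ResFock :=
  pullback (fun I => if j ∈ I then 0 else fermiSign j I) (fun I => insert j I)
    (fun I => by
      split_ifs
      · simp
      · simp [fermiSign])
    (by
      intro I hI J hJ h
      have hI' : j ∉ I := fun h' => hI (by simp [h'])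
      have hJ' : j ∉ J := fun h' => hJ (by simp [h'])
      have h' : insert j I = insert j J := h
      rw [← Finset.erase_insert hI', ← Finset.erase_insert hJ', h'])

/-- The second quantization `Γ(S)` of the shift `S Ψ_j = Ψ_{j-1}`: it maps `e_I` to `e_{I-1}`
(no sign, since the shift preserves the order), that is `(Γ(S) f)(I) = f(I + 1)`. -/
def resShift : ResFock →L[ℂ] ResFock :=
  pullback (fun _ => 1) (fun I => I.map (addRightEmbedding (1 : ℤ)))
    (fun _ => by simp) (fun _ _ _ _ h => Finset.map_injective _ h)

theorem resShift_star_mul_self : star resShift * resShift = 1 := by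
  have hu : ∀ f g : ResFock, inner ℂ (resShift f) (resShift g) = inner ℂ f g := by
    intro f g
    rw [lp.inner_eq_tsum, lp.inner_eq_tsum]
    have e : ∀ I : Finset ℤ, inner ℂ ((resShift f : ResFock) I) ((resShift g : ResFock) I)
        = inner ℂ (f (Equiv.finsetCongr (Equiv.addRight (1 : ℤ)) I))
          (g (Equiv.finsetCongr (Equiv.addRight (1 : ℤ)) I)) := by
      intro I
      have : ∀ h : ResFock, (resShift h : ResFock) I
          = h (Equiv.finsetCongr (Equiv.addRight (1 : ℤ)) I) := by
        intro h
        change 1 * h _ = _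
        rw [one_mul]
        rfl
      rw [this, this]
    simp_rw [e]
    exact (Equiv.finsetCongr (Equiv.addRight (1 : ℤ))).tsum_eq (fun J => inner ℂ (f J) (g J))
  ext1 f
  refine ext_inner_left ℂ fun g => ?_
  rw [mul_apply_eq_comp, ContinuousLinearMap.star_eq_adjoint,
    ContinuousLinearMap.adjoint_inner_right, hu]
  rfl

theorem resAnn_mul_resShift (j : ℤ) :
    resAnn j * resShift = resShift * resAnn (j + 1) := by
  ext f I
  change (if j ∈ I then 0 else fermiSign j I) *
      (1 * f ((insert j I).map (addRightEmbedding (1 : ℤ))))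
    = 1 * ((if j + 1 ∈ I.map (addRightEmbedding (1 : ℤ)) then 0
        else fermiSign (j + 1) (I.map (addRightEmbedding (1 : ℤ)))) *
      f (insert (j + 1) (I.map (addRightEmbedding (1 : ℤ)))))
  have h1 : (j + 1 ∈ I.map (addRightEmbedding (1 : ℤ))) ↔ j ∈ I := by simp
  have h2 : fermiSign (j + 1) (I.map (addRightEmbedding (1 : ℤ))) = fermiSign j I := by
    unfold fermiSign
    rw [Finset.filter_map, Finset.card_map]
    congr 2
    ext i
    simp
  rw [h2, Finset.map_insert]
  simp only [h1]
  rw [one_mul, one_mul]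
  rfl

/-- The `C^*`-algebra `𝓑` of the reservoir, generated by the creation and annihilation
operators. -/
def resAlg : StarSubalgebra ℂ (ResFock →L[ℂ] ResFock) :=
  (StarAlgebra.adjoin ℂ (Set.range resAnn)).topologicalClosure

theorem resAnn_mem (j : ℤ) : resAnn j ∈ resAlg :=
  StarSubalgebra.le_topologicalClosure _ (StarAlgebra.subset_adjoin ℂ _ ⟨j, rfl⟩)

theorem resShift_mul_star_self : resShift * star resShift = 1 := by
  have hs : Function.Surjective resShift := by
    intro f
    refine ⟨pullback (fun _ => 1) (fun I => I.map (addRightEmbedding (-1 : ℤ)))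
      (fun _ => by simp) (fun _ _ _ _ h => Finset.map_injective _ h) f, ?_⟩
    ext I
    change 1 * (1 * f ((I.map (addRightEmbedding (1 : ℤ))).map (addRightEmbedding (-1 : ℤ)))) = f I
    have hI : (I.map (addRightEmbedding (1 : ℤ))).map (addRightEmbedding (-1 : ℤ)) = I := by
      rw [Finset.map_map]
      ext i
      simp
    rw [one_mul, one_mul]
    rw [hI]
  ext1 f
  obtain ⟨g, rfl⟩ := hs f
  have h := congrArg (fun T : ResFock →L[ℂ] ResFock => T g) resShift_star_mul_self
  exact congrArg resShift h

/-- The free evolution `X ↦ Γ(S)^* X Γ(S)` maps `𝓑` into itself. -/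
theorem resShift_conj_mem {X : ResFock →L[ℂ] ResFock} (hX : X ∈ resAlg) :
    star resShift * X * resShift ∈ resAlg := by
  have key : ∀ Y ∈ StarAlgebra.adjoin ℂ (Set.range resAnn),
      star resShift * Y * resShift ∈ resAlg := by
    intro Y hY
    induction hY using StarAlgebra.adjoin_induction with
    | mem x hx =>
      obtain ⟨j, rfl⟩ := hx
      rw [mul_assoc, resAnn_mul_resShift, ← mul_assoc, resShift_star_mul_self, one_mul]
      exact resAnn_mem _
    | algebraMap r =>
      rw [Algebra.algebraMap_eq_smul_one, mul_smul_comm, smul_mul_assoc, mul_one,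
        resShift_star_mul_self]
      exact resAlg.smul_mem (one_mem _) r
    | add x y _ _ hx hy =>
      rw [mul_add, add_mul]
      exact add_mem hx hy
    | mul x y _ _ hx hy =>
      have : star resShift * (x * y) * resShift
          = (star resShift * x * resShift) * (star resShift * y * resShift) := by
        calc star resShift * (x * y) * resShift
            = star resShift * x * 1 * y * resShift := by simp only [mul_one, mul_assoc]
          _ = _ := by rw [← resShift_mul_star_self]; simp only [mul_assoc]
      rw [this]
      exact mul_mem hx hy
    | star x _ hx =>
      have : star resShift * star x * resShift = star (star resShift * x * resShift) := by
        simp only [star_mul, star_star, mul_assoc]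
      rw [this]
      exact star_mem hx
  have hcont : Continuous fun Y : ResFock →L[ℂ] ResFock => star resShift * Y * resShift := by
    fun_prop
  have hcl : IsClosed {Y : ResFock →L[ℂ] ResFock | star resShift * Y * resShift ∈ resAlg} :=
    (StarSubalgebra.isClosed_topologicalClosure _).preimage hcont
  exact closure_minimal (fun Y hY => key Y hY) hcl hX

/-! ### States of the reservoir -/

/-- A state on `𝓑`: a normalized positive linear functional. -/
def IsState (ω : resAlg →ₗ[ℂ] ℂ) : Prop :=
  ω 1 = 1 ∧ ∀ X : resAlg, 0 ≤ ω (star X * X)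

/-- The annihilation operator `b_j` as an element of `𝓑`. -/
def resB (j : ℤ) : resAlg := ⟨resAnn j, resAnn_mem j⟩

/-- `ω` is the gauge-invariant quasi-free functional with symbol `Sig` (given by its matrix in the
canonical basis of `ℓ²(ℤ)`):
`ω(b^*(φ_m) ⋯ b^*(φ_1) b(ψ_1) ⋯ b(ψ_n)) = δ_{nm} det (⟨ψ_j, Sig φ_k⟩)`.
Both sides are multilinear and continuous in the `φ`'s (linear) and `ψ`'s (antilinear), so the
relation is required for canonical basis vectors. -/
def IsQuasiFree (Sig : Matrix ℤ ℤ ℂ) (ω : resAlg →ₗ[ℂ] ℂ) : Prop :=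
  (∀ (n : ℕ) (p q : Fin n → ℤ),
    ω (((List.ofFn fun k => star (resB (p k))).reverse).prod
        * (List.ofFn fun j => resB (q j)).prod)
      = Matrix.det (Matrix.of fun j k => Sig (q j) (p k))) ∧
  (∀ (m n : ℕ) (p : Fin m → ℤ) (q : Fin n → ℤ), m ≠ n →
    ω (((List.ofFn fun k => star (resB (p k))).reverse).prod
        * (List.ofFn fun j => resB (q j)).prod) = 0)

/-! ### The sample -/

/-- Operators on the antisymmetric Fock space over `ℂ^d`, as matrices in the basis `e_I`. -/
abbrev SampleOp (d : ℕ) : Type := Matrix (Finset (Fin d)) (Finset (Fin d)) ℂ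

/-- The annihilation operator `a_j`; its conjugate transpose is the creation operator `a_j^*`. -/
def sampleAnn {d : ℕ} (j : Fin d) : SampleOp d :=
  Matrix.of fun I J => if j ∉ I ∧ J = insert j I then fermiSign j I else 0

/-- The creation operator `a^*(ψ) = ∑ k, ψ_k a_k^*`. -/
def sampleCre {d : ℕ} (ψ : Fin d → ℂ) : SampleOp d := ∑ k, ψ k • (sampleAnn k)ᴴ

/-- The vacuum vector `Ω = e_∅`. -/
def sampleVac (d : ℕ) : Finset (Fin d) → ℂ := Pi.single ∅ 1

/-- The second quantization `Γ(W)`: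
`Γ(W) (e_{j₁} ∧ ... ∧ e_{jₚ}) = W e_{j₁} ∧ ... ∧ W e_{jₚ} = a^*(W e_{j₁}) ⋯ a^*(W e_{jₚ}) Ω`
for `j₁ < ... < jₚ`. -/
def sampleΓ {d : ℕ} (W : Matrix (Fin d) (Fin d) ℂ) : SampleOp d :=
  Matrix.of fun I J =>
    (((J.sort).map fun j => sampleCre fun k => W k j).prod *ᵥ sampleVac d) I

/-- A density matrix on the Fock space of the sample. -/
def IsDensity {d : ℕ} (ρ : SampleOp d) : Prop := ρ.PosSemidef ∧ ρ.trace = 1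

/-! ### The coupled system

The bounded operators on the tensor product of the reservoir Fock space with the
(finite dimensional) sample Fock space are the block matrices
`X = (X_{IJ})`, `X_{IJ} = ⟨e_I| X |e_J⟩`, whose entries are bounded operators on the reservoir
Fock space. -/

/-- Bounded operators on the Fock space of the coupled system. -/
abbrev TotalOp (d : ℕ) : Type :=
  Matrix (Finset (Fin d)) (Finset (Fin d)) (ResFock →L[ℂ] ResFock)

/-- `B ⊗ A`. -/
def tens {d : ℕ} (B : ResFock →L[ℂ] ResFock) (A : SampleOp d) : TotalOp d :=
  Matrix.of fun I J => A I J • B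

/-- The coupling `K = exp (-i α (b_0^* ⊗ a_0 + b_0 ⊗ a_0^*))`. -/
def coupling (d : ℕ) [NeZero d] (α : ℝ) : TotalOp d :=
  NormedSpace.exp ((-(Complex.I * (α : ℂ))) •
    (tens (star (resAnn 0)) (sampleAnn (0 : Fin d)) + tens (resAnn 0) (sampleAnn (0 : Fin d))ᴴ))

/-- The one time step operator `U = (Γ(S) ⊗ Γ(W)) K`. -/
def stepU {d : ℕ} [NeZero d] (W : Matrix (Fin d) (Fin d) ℂ) (α : ℝ) : TotalOp d :=
  tens resShift (sampleΓ W) * coupling d α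

/-- The time evolution `τ^t(X) = (U^*)^t X U^t`. -/
def evol {d : ℕ} [NeZero d] (W : Matrix (Fin d) (Fin d) ℂ) (α : ℝ) (t : ℕ) (X : TotalOp d) :
    TotalOp d :=
  (stepU W α)ᴴ ^ t * X * stepU W α ^ t

theorem coupling_mem (d : ℕ) [NeZero d] (α : ℝ) (I J : Finset (Fin d)) :
    coupling d α I J ∈ resAlg := by
  let S : Subalgebra ℂ (TotalOp d) := resAlg.toSubalgebra.matrix
  have hcl : IsClosed (S : Set (TotalOp d)) := by
    have h : (S : Set (TotalOp d))
        = ⋂ I, ⋂ J, (fun X : TotalOp d => X I J) ⁻¹' (resAlg : Set (ResFock →L[ℂ] ResFock)) := by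
      ext X
      simp only [Set.mem_iInter]
      rfl
    rw [h]
    exact isClosed_iInter fun I => isClosed_iInter fun J =>
      (StarSubalgebra.isClosed_topologicalClosure _).preimage (by fun_prop)
  have hH : (-(Complex.I * (α : ℂ))) •
    (tens (star (resAnn 0)) (sampleAnn (0 : Fin d)) + tens (resAnn 0) (sampleAnn (0 : Fin d))ᴴ)
      ∈ S := by
    refine S.smul_mem (S.add_mem ?_ ?_) _
    · intro I J
      exact resAlg.smul_mem (star_mem (resAnn_mem 0)) _
    · intro I J
      exact resAlg.smul_mem (resAnn_mem 0) _
  have : coupling d α ∈ S := by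
    rw [coupling, NormedSpace.exp_eq_tsum ℂ]
    exact tsum_mem hcl fun n => S.smul_mem (S.pow_mem hH n) _
  exact this I J

/-- The time evolution preserves `𝓑 ⊗ 𝓐`, the block matrices with entries in `𝓑`. -/
theorem evol_mem {d : ℕ} [NeZero d] (W : Matrix (Fin d) (Fin d) ℂ) (α : ℝ) (t : ℕ)
    (X : TotalOp d) (hX : ∀ I J, X I J ∈ resAlg) (I J : Finset (Fin d)) :
    evol W α t X I J ∈ resAlg := by
  let S : Subalgebra ℂ (TotalOp d) := resAlg.toSubalgebra.matrix
  have hK : coupling d α ∈ S := fun I J => coupling_mem d α I J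
  have hK' : (coupling d α)ᴴ ∈ S := fun I J => resAlg.star_mem' (coupling_mem d α J I)
  have hF : ∀ Y ∈ S, (tens resShift (sampleΓ W))ᴴ * Y * tens resShift (sampleΓ W) ∈ S := by
    intro Y hY I J
    rw [Matrix.mul_apply]
    refine sum_mem fun L _ => ?_
    rw [Matrix.mul_apply, Finset.sum_mul]
    refine sum_mem fun M _ => ?_
    have : (tens resShift (sampleΓ W))ᴴ I M * Y M L * tens resShift (sampleΓ W) L J
        = (star (sampleΓ W M I) * sampleΓ W L J) • (star resShift * Y M L * resShift) := by
      simp only [tens, Matrix.conjTranspose_apply, Matrix.of_apply, star_smul, smul_mul_assoc,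
        mul_smul_comm, smul_smul]
      rw [mul_comm]
    rw [this]
    exact resAlg.smul_mem (resShift_conj_mem (hY M L)) _
  have hstep : ∀ Y ∈ S, (stepU W α)ᴴ * Y * stepU W α ∈ S := by
    intro Y hY
    have : (stepU W α)ᴴ * Y * stepU W α = (coupling d α)ᴴ *
        ((tens resShift (sampleΓ W))ᴴ * Y * tens resShift (sampleΓ W)) * coupling d α := by
      simp only [stepU, Matrix.conjTranspose_mul, mul_assoc]
    rw [this]
    exact S.mul_mem (S.mul_mem hK' (hF Y hY)) hK
  have : evol W α t X ∈ S := by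
    induction t with
    | zero => simpa [evol] using (show X ∈ S from hX)
    | succ t ih =>
      have : evol W α (t + 1) X = (stepU W α)ᴴ * evol W α t X * stepU W α := by
        simp only [evol]
        rw [pow_succ', pow_succ]
        simp only [mul_assoc]
      rw [this]
      exact hstep _ ih
  exact this I J

/-- The element `τ^t(1 ⊗ A)` of `𝓑 ⊗ 𝓐`. -/
def evolObs {d : ℕ} [NeZero d] (W : Matrix (Fin d) (Fin d) ℂ) (α : ℝ) (t : ℕ) (A : SampleOp d) :
    Matrix (Finset (Fin d)) (Finset (Fin d)) resAlg :=
  Matrix.of fun I J => ⟨evol W α t (tens 1 A) I J,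
    evol_mem W α t _ (fun _ _ => resAlg.smul_mem (one_mem _) _) I J⟩

/-- The product state `ω ⊗ ρ` on `𝓑 ⊗ 𝓐`, with `(ω ⊗ ρ)(B ⊗ A) = ω(B) tr(ρ A)`. -/
def prodState {d : ℕ} (ω : resAlg →ₗ[ℂ] ℂ) (ρ : SampleOp d)
    (X : Matrix (Finset (Fin d)) (Finset (Fin d)) resAlg) : ℂ :=
  (ρ * X.map ω).trace

/-- The expectation `ρ_t(A) = (ω ⊗ ρ)(τ^t(1 ⊗ A))` of a sample observable at time `t`. -/
def expect {d : ℕ} [NeZero d] (ω : resAlg →ₗ[ℂ] ℂ) (W : Matrix (Fin d) (Fin d) ℂ) (α : ℝ)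
    (ρ : SampleOp d) (t : ℕ) (A : SampleOp d) : ℂ :=
  prodState ω ρ (evolObs W α t A)

/-- The `p`-body reduced density matrix at time `t`, in the orthonormal basis
`e_{j₁} ∧ ... ∧ e_{jₚ}`, `j₁ < ... < jₚ`, of the `p`-th antisymmetric power of `ℂ^d`:
`⟨e_{j₁} ∧ ... ∧ e_{jₚ}| ρ_t^{(p)} e_{k₁} ∧ ... ∧ e_{kₚ}⟩
  = ρ_t(a_{k₁}^* ⋯ a_{kₚ}^* a_{jₚ} ⋯ a_{j₁})`. -/
def reducedDM {d : ℕ} [NeZero d] (p : ℕ) (ω : resAlg →ₗ[ℂ] ℂ) (W : Matrix (Fin d) (Fin d) ℂ)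
    (α : ℝ) (ρ : SampleOp d) (t : ℕ) :
    Matrix {j : Fin p → Fin d // StrictMono j} {j : Fin p → Fin d // StrictMono j} ℂ :=
  Matrix.of fun j k => expect ω W α ρ t
    ((List.ofFn fun i => (sampleAnn (k.1 i))ᴴ).prod
      * ((List.ofFn fun i => sampleAnn (j.1 i)).reverse).prod)

/-- The number operator `n_j = a_j^* a_j` of site `j` of the sample. -/
def sampleNum {d : ℕ} (j : Fin d) : SampleOp d := (sampleAnn j)ᴴ * sampleAnn j

/-- Thermalization at density `σ`: for every initial density matrix of the sample the one- and
two-body reduced density matrices converge to `σ 1` and `σ² 1`, the density profile becomes flat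
and the correlations become constant. -/
def Thermalizes {d : ℕ} [NeZero d] (ω : resAlg →ₗ[ℂ] ℂ) (W : Matrix (Fin d) (Fin d) ℂ)
    (α σ : ℝ) : Prop :=
  ∀ ρ : SampleOp d, IsDensity ρ →
    Tendsto (fun t => reducedDM 1 ω W α ρ t) atTop (𝓝 ((σ : ℂ) • 1)) ∧
    Tendsto (fun t => reducedDM 2 ω W α ρ t) atTop (𝓝 (((σ : ℂ) ^ 2) • 1)) ∧
    (∀ j : Fin d, Tendsto (fun t => expect ω W α ρ t (sampleNum j)) atTop (𝓝 (σ : ℂ))) ∧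
    (∀ j k : Fin d, j ≠ k →
      Tendsto (fun t => expect ω W α ρ t (sampleNum j * sampleNum k)) atTop (𝓝 ((σ : ℂ) ^ 2)))

/-! ### Coined quantum walks -/

/-- The group `U(2)` of coin matrices; the spin `+1` has index `0` and the spin `-1` index `1`. -/
abbrev Coin : Type := Matrix.unitaryGroup (Fin 2) ℂ

/-- The coined quantum walk on the circle `{0, ..., n-1}`,
`V(C) = ∑_x (|x+1⟩⟨x| ⊗ P_{+1} C_x + |x-1⟩⟨x| ⊗ P_{-1} C_x)`, with periodic addition. -/
def circleWalk {n : ℕ} [NeZero n] (C : Fin n → Coin) :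
    Matrix (Fin n × Fin 2) (Fin n × Fin 2) ℂ :=
  ∑ x : Fin n,
    (Matrix.single (x + 1) x (1 : ℂ) ⊗ₖ (Matrix.single 0 0 (1 : ℂ) * (C x : Matrix (Fin 2) (Fin 2) ℂ))
      + Matrix.single (x - 1) x (1 : ℂ) ⊗ₖ
        (Matrix.single 1 1 (1 : ℂ) * (C x : Matrix (Fin 2) (Fin 2) ℂ)))

/-- The walk with periodic boundary conditions as a matrix `W` in the basis
`e_0 = |+1, 0⟩, e_1 = |-1, 0⟩, e_2 = |+1, 1⟩, e_3 = |-1, 1⟩, ...` of `ℂ^{2n}`. -/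
def periodicWalk {n : ℕ} [NeZero n] (C : Fin n → Coin) : Matrix (Fin (n * 2)) (Fin (n * 2)) ℂ :=
  Matrix.reindex finProdFinEquiv finProdFinEquiv (circleWalk C)

/-- The coin matrix that exchanges the two spin states. -/
def swapCoin : Coin :=
  ⟨!![0, 1; 1, 0], by
    rw [Matrix.mem_unitaryGroup_iff]
    ext i j
    fin_cases i <;> fin_cases j <;> simp [Matrix.mul_apply, Fin.sum_univ_two, Matrix.star_apply]⟩

/-- The coins on the sites `{0, ..., m+1}` with the exchange coin at the two boundary sites and
`C i` at the interior site `i + 1`. -/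
def dirichletCoins {m : ℕ} (C : Fin m → Coin) (x : Fin (m + 2)) : Coin :=
  if h : 0 < x.1 ∧ x.1 < m + 1 then C ⟨x.1 - 1, by omega⟩ else swapCoin

/-- The walk with Dirichlet boundary conditions on the sites `{0, ..., m+1}`: the restriction of
the walk with coins `dirichletCoins C` to the orthogonal complement of the invariant subspace
spanned by `|+1, 0⟩` and `|-1, m+1⟩`, in the basis
`e_0 = |-1, 0⟩, e_1 = |+1, 1⟩, e_2 = |-1, 1⟩, ..., e_{2m+1} = |+1, m+1⟩` of `ℂ^{2(m+1)}`. -/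
def dirichletWalk {m : ℕ} (C : Fin m → Coin) : Matrix (Fin (m * 2 + 2)) (Fin (m * 2 + 2)) ℂ :=
  (periodicWalk (dirichletCoins C)).submatrix
    (fun j => ⟨j.1 + 1, by omega⟩) (fun j => ⟨j.1 + 1, by omega⟩)

/-- The vector `e_0` is cyclic for `W`. -/
def CyclicZero {d : ℕ} [NeZero d] (W : Matrix (Fin d) (Fin d) ℂ) : Prop :=
  Submodule.span ℂ (Set.range fun k : ℕ => (W ^ k) *ᵥ (Pi.single (0 : Fin d) (1 : ℂ))) = ⊤

/-- A set of coin configurations is generic: it is open and dense in `U(2)^n` and its complement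
is negligible for Haar measure. -/
def GenericCoins {n : ℕ} (G : Set (Fin n → Coin)) : Prop :=
  IsOpen G ∧ Dense G ∧
    ∀ μ : @MeasureTheory.Measure (Fin n → Coin) (borel (Fin n → Coin)),
      @MeasureTheory.Measure.IsHaarMeasure (Fin n → Coin) _ _ (borel (Fin n → Coin)) μ → μ Gᶜ = 0

end FermiWalk

end

/-! The model is quasi-free, so everything reduces to a $d\times d$ matrix. In the ungraded tensor
product sample and reservoir operators commute. For the generator $H=b_0^*\otimes a_0+b_0\otimes
a_0^*$ it is therefore the anticommutator, not the commutator, that maps linear combinations of the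
$a_j$ and $b_m$ to such combinations. Hence $x\mapsto KxK$ preserves linear observables. Although
this is not conjugation by $K$, the inner factors cancel in $x^*y$, because $(KxK)^*(KyK)=K^*x^*yK$.
Pairs $a_i^*a_j$ thus evolve through the linear map `linStep` (`evol_conjTranspose_mul`).

Iteration turns $a_j$ into $\sum_k (M^t)_{jk}a_k$ plus a combination of $b_0,\dots,b_{t-1}$, where
$M=WD$ is `damped`, $D=\mathrm{diag}(\cos\alpha,1,\dots,1)$ (`linStep_iterate`). Amplitude lost by
the sample is found in the reservoir: the Gram matrix of the reservoir coefficients is, up to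
transposition, $1-M^t(M^t)^*$ (`resGram_eq`). If $M^t\to0$, all memory of $\rho$ disappears, the
Gram matrix tends to the identity, and Wick's formula for symbol $\sigma$ yields the limits
(`prodState_two`, `prodState_four`).

Since $W$ is unitary and $|\cos\alpha|<1$, an eigenvector of $M$ with eigenvalue of modulus at least
one must vanish at site $0$ and is then an eigenvector of $W$. So $M^t\to0$ as soon as no nonzero
eigenvector of $W$ vanishes at $0$ (`NoDarkState`). Cyclicity of $e_0$ excludes such vectors by
orthogonality to the Krylov space. For the Dirichlet walk they are excluded by propagating zeros
from the left boundary site by site.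

Genericity rests on analyticity. Cyclicity means that some Krylov determinant is nonzero; one of
them is nonzero at an explicit configuration where $W$ is a cyclic permutation of the basis. Any
configuration is multiplied into that one along an analytic curve in the group, and a nontrivial
analytic function of one real variable vanishes only on a null set. This gives density, and Fubini
together with left invariance gives Haar measure zero. -/

noncomputable section

namespace FermiWalk

/-! ### Canonical anticommutation relations -/

section CAR

variable {ι : Type*} [LinearOrder ι]

/-- The annihilation operator on functions of the occupied set. -/
def fAnn (j : ι) (f : Finset ι → ℂ) (I : Finset ι) : ℂ :=
  if j ∈ I then 0 else fermiSign j I * f (insert j I)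

/-- The creation operator on functions of the occupied set. -/
def fCre (j : ι) (f : Finset ι → ℂ) (I : Finset ι) : ℂ :=
  if j ∈ I then fermiSign j I * f (I.erase j) else 0

theorem fermiSign_mul_self (j : ι) (I : Finset ι) : fermiSign j I * fermiSign j I = 1 := by
  unfold fermiSign
  rw [← mul_pow]
  simp

theorem fermiSign_insert {i : ι} (j : ι) {I : Finset ι} (hi : i ∉ I) :
    fermiSign j (insert i I) = if i < j then -fermiSign j I else fermiSign j I := by
  unfold fermiSign
  rw [Finset.filter_insert]
  split_ifs with h
  · rw [Finset.card_insert_of_notMem (by simp [hi]), pow_succ]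
    ring
  · rfl

theorem fermiSign_insert_self (j : ι) (I : Finset ι) :
    fermiSign j (insert j I) = fermiSign j I := by
  by_cases h : j ∈ I
  · rw [Finset.insert_eq_of_mem h]
  · simp [fermiSign_insert j h]

theorem fermiSign_erase_self (j : ι) (I : Finset ι) :
    fermiSign j (I.erase j) = fermiSign j I := by
  rw [← fermiSign_insert_self j (I.erase j)]
  by_cases h : j ∈ I
  · rw [Finset.insert_erase h]
  · rw [Finset.erase_eq_of_notMem h, fermiSign_insert_self]

theorem fermiSign_erase {i : ι} (j : ι) {I : Finset ι} (hi : i ∈ I) :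
    fermiSign j (I.erase i) = if i < j then -fermiSign j I else fermiSign j I := by
  conv_rhs => rw [← Finset.insert_erase hi, fermiSign_insert j (Finset.notMem_erase i I)]
  split_ifs <;> simp

/-- For distinct $i,j\notin I$ both terms evaluate `f` at the same set. Inserting the smaller index
flips the sign attached to the larger one and not conversely, so exactly one of the two terms
changes sign. -/
theorem fAnn_fAnn (i j : ι) (f : Finset ι → ℂ) (I : Finset ι) :
    fAnn i (fAnn j f) I + fAnn j (fAnn i f) I = 0 := by
  unfold fAnn
  by_cases hij : i = j
  · subst hij
    simp
  by_cases hi : i ∈ I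
  · simp [hi]
  by_cases hj : j ∈ I
  · simp [hj]
  have hji : j ≠ i := fun h => hij h.symm
  simp only [hi, hj, Finset.mem_insert, hij, hji, if_false, or_self, fermiSign_insert j hi,
    fermiSign_insert i hj, Finset.insert_comm j i]
  rcases lt_or_gt_of_ne hij with h | h
  · rw [if_pos h, if_neg h.not_gt]
    ring
  · rw [if_neg h.not_gt, if_pos h]
    ring

theorem fAnn_fCre_of_ne {i j : ι} (hij : i ≠ j) (f : Finset ι → ℂ) (I : Finset ι) :
    fAnn i (fCre j f) I + fCre j (fAnn i f) I = 0 := by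
  unfold fAnn fCre
  by_cases hi : i ∈ I
  · simp [hi, hij]
  by_cases hj : j ∈ I
  · simp only [hi, hj, Finset.mem_insert, if_true, or_true, if_false, Finset.mem_erase,
      and_false, fermiSign_insert j hi, fermiSign_erase i hj,
      Finset.erase_insert_of_ne hij]
    rcases lt_or_gt_of_ne hij with h | h
    · rw [if_pos h, if_neg h.not_gt]
      ring
    · rw [if_neg h.not_gt, if_pos h]
      ring
  · have hji : j ≠ i := fun h => hij h.symm
    simp [hi, hj, hji]

theorem fAnn_fCre_self (i : ι) (f : Finset ι → ℂ) (I : Finset ι) :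
    fAnn i (fCre i f) I + fCre i (fAnn i f) I = f I := by
  unfold fAnn fCre
  by_cases hi : i ∈ I
  · simp only [hi, if_true, Finset.notMem_erase, if_false, fermiSign_erase_self,
      Finset.insert_erase hi, ← mul_assoc, fermiSign_mul_self]
    ring
  · simp only [hi, if_false, Finset.mem_insert_self, if_true, fermiSign_insert_self,
      Finset.erase_insert hi, ← mul_assoc, fermiSign_mul_self]
    ring

end CAR

theorem star_fermiSign {ι : Type*} [LinearOrder ι] (j : ι) (I : Finset ι) :
    star (fermiSign j I) = fermiSign j I := by
  simp [fermiSign]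

/-! ### The sample -/

section Sample

variable {d : ℕ}

theorem sampleAnn_mulVec (j : Fin d) (f : Finset (Fin d) → ℂ) :
    sampleAnn j *ᵥ f = fAnn j f := by
  ext I
  simp only [Matrix.mulVec, dotProduct, sampleAnn, Matrix.of_apply, fAnn]
  by_cases h : j ∈ I
  · simp [h]
  · simp [h]

theorem sampleAnn_conjTranspose_mulVec (j : Fin d) (f : Finset (Fin d) → ℂ) :
    (sampleAnn j)ᴴ *ᵥ f = fCre j f := by
  ext I
  simp only [Matrix.mulVec, dotProduct, sampleAnn, Matrix.conjTranspose_apply, Matrix.of_apply,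
    fCre]
  by_cases h : j ∈ I
  · rw [if_pos h, Finset.sum_eq_single (I.erase j)]
    · rw [if_pos ⟨Finset.notMem_erase j I, (Finset.insert_erase h).symm⟩, star_fermiSign,
        fermiSign_erase_self]
    · intro J _ hJ
      rw [if_neg, star_zero, zero_mul]
      rintro ⟨h1, rfl⟩
      exact hJ (Finset.erase_insert h1).symm
    · simp
  · rw [if_neg h]
    refine Finset.sum_eq_zero fun J _ => ?_
    rw [if_neg, star_zero, zero_mul]
    rintro ⟨-, rfl⟩
    exact h (Finset.mem_insert_self j J)

theorem eq_of_mulVec {A B : SampleOp d} (h : ∀ f, A *ᵥ f = B *ᵥ f) : A = B :=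
  Matrix.mulVec_injective (funext h)

theorem sampleAnn_anticomm (i j : Fin d) :
    sampleAnn i * sampleAnn j + sampleAnn j * sampleAnn i = 0 := by
  refine eq_of_mulVec fun f => ?_
  ext I
  simp only [Matrix.add_mulVec, ← Matrix.mulVec_mulVec, sampleAnn_mulVec, Matrix.zero_mulVec]
  exact fAnn_fAnn i j f I

theorem sampleAnn_car (i j : Fin d) :
    sampleAnn i * (sampleAnn j)ᴴ + (sampleAnn j)ᴴ * sampleAnn i = if i = j then 1 else 0 := by
  refine eq_of_mulVec fun f => ?_
  ext I
  simp only [Matrix.add_mulVec, ← Matrix.mulVec_mulVec, sampleAnn_mulVec,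
    sampleAnn_conjTranspose_mulVec]
  by_cases h : i = j
  · subst h
    simpa using fAnn_fCre_self i f I
  · simpa [h] using fAnn_fCre_of_ne h f I

theorem sampleAnn_conjTranspose_anticomm (i j : Fin d) :
    (sampleAnn i)ᴴ * (sampleAnn j)ᴴ = -((sampleAnn j)ᴴ * (sampleAnn i)ᴴ) := by
  rw [← Matrix.conjTranspose_mul, ← Matrix.conjTranspose_mul, ← Matrix.conjTranspose_neg,
    eq_neg_of_add_eq_zero_left (sampleAnn_anticomm j i)]

theorem sampleCre_anticomm (ψ φ : Fin d → ℂ) :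
    sampleCre ψ * sampleCre φ = -(sampleCre φ * sampleCre ψ) := by
  simp only [sampleCre, Finset.sum_mul, Finset.mul_sum, ← Finset.sum_neg_distrib]
  rw [Finset.sum_comm]
  refine Finset.sum_congr rfl fun i _ => Finset.sum_congr rfl fun j _ => ?_
  rw [smul_mul_smul_comm, smul_mul_smul_comm, sampleAnn_conjTranspose_anticomm, smul_neg, mul_comm]

theorem sampleCre_mul_self (ψ : Fin d → ℂ) : sampleCre ψ * sampleCre ψ = 0 := by
  ext I J
  exact self_eq_neg.1 (congrFun (congrFun (sampleCre_anticomm ψ ψ) I) J)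

theorem sampleAnn_mul_sampleCre (j : Fin d) (ψ : Fin d → ℂ) :
    sampleAnn j * sampleCre ψ = ψ j • 1 - sampleCre ψ * sampleAnn j := by
  rw [eq_sub_iff_add_eq]
  simp only [sampleCre, Finset.sum_mul, Finset.mul_sum, ← Finset.sum_add_distrib, mul_smul_comm,
    smul_mul_assoc, ← smul_add, sampleAnn_car]
  simp

theorem sampleAnn_mulVec_vac (j : Fin d) : sampleAnn j *ᵥ sampleVac d = 0 := by
  rw [sampleAnn_mulVec]
  ext I
  simp only [fAnn, sampleVac, Pi.single_apply, Pi.zero_apply]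
  split_ifs with h1 h2
  · rfl
  · exact absurd h2 (Finset.insert_ne_empty j I)
  · simp

theorem sampleCre_mulVec_empty (ψ : Fin d → ℂ) (f : Finset (Fin d) → ℂ) :
    (sampleCre ψ *ᵥ f) ∅ = 0 := by
  simp only [sampleCre, Matrix.sum_mulVec, Finset.sum_apply, Matrix.smul_mulVec, Pi.smul_apply,
    sampleAnn_conjTranspose_mulVec]
  exact Finset.sum_eq_zero fun k _ => by simp [fCre]

/-- Moving a creation operator to the front of a product over a set. -/
theorem sampleCre_mul_prod_sort (φ : Fin d → Fin d → ℂ) (k : Fin d) (J : Finset (Fin d)) :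
    sampleCre (φ k) * ((J.sort).map fun j => sampleCre (φ j)).prod
      = if k ∈ J then 0
        else fermiSign k J • (((insert k J).sort).map fun j => sampleCre (φ j)).prod := by
  -- Adding a new minimum `a` puts its factor at the head of the ordered product; the three cases
  -- compare `k` with this head, and only $k>a$ requires an anticommutation.
  induction J using Finset.induction_on_min with
  | empty => simp [fermiSign]
  | insert a J ha ih =>
    have haJ : a ∉ J := fun h => lt_irrefl _ (ha a h)
    rw [Finset.sort_insert _ (fun b hb => (ha b hb).le) haJ, List.map_cons, List.prod_cons]
    rcases lt_trichotomy k a with h | h | h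
    · have hk : k ∉ insert a J := by
        intro h'
        rcases Finset.mem_insert.1 h' with h' | h'
        · exact h.ne h'
        · exact lt_asymm h (ha _ h')
      have hs : fermiSign k (insert a J) = 1 := by
        unfold fermiSign
        rw [Finset.filter_eq_empty_iff.2]
        · simp
        · intro b hb
          rcases Finset.mem_insert.1 hb with rfl | hb
          · exact h.not_gt
          · exact (h.trans (ha b hb)).not_gt
      have hmin : ∀ b ∈ insert a J, k ≤ b := by
        intro b hb
        rcases Finset.mem_insert.1 hb with rfl | hb
        · exact h.le
        · exact (h.trans (ha b hb)).le
      rw [if_neg hk, hs, one_smul, Finset.sort_insert _ hmin hk,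
        Finset.sort_insert _ (fun b hb => (ha b hb).le) haJ, List.map_cons, List.prod_cons,
        List.map_cons, List.prod_cons]
    · subst h
      rw [if_pos (Finset.mem_insert_self k J), ← mul_assoc, sampleCre_mul_self, zero_mul]
    · rw [← mul_assoc, sampleCre_anticomm, neg_mul, mul_assoc, ih]
      by_cases hk : k ∈ J
      · rw [if_pos hk, if_pos (Finset.mem_insert_of_mem hk), mul_zero, neg_zero]
      · have hk' : k ∉ insert a J := by
          intro h'
          rcases Finset.mem_insert.1 h' with h' | h'
          · exact h.ne' h'
          · exact hk h'
        have ha' : a ∉ insert k J := by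
          intro h'
          rcases Finset.mem_insert.1 h' with h' | h'
          · exact h.ne h'
          · exact haJ h'
        have hmin : ∀ b ∈ insert k J, a ≤ b := by
          intro b hb
          rcases Finset.mem_insert.1 hb with rfl | hb
          · exact h.le
          · exact (ha b hb).le
        rw [if_neg hk, if_neg hk', fermiSign_insert k haJ, if_pos h, Finset.insert_comm,
          Finset.sort_insert _ hmin ha', List.map_cons, List.prod_cons, mul_smul_comm, neg_smul]

theorem sampleΓ_mulVec_single (W : Matrix (Fin d) (Fin d) ℂ) (J : Finset (Fin d)) :
    sampleΓ W *ᵥ Pi.single J 1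
      = ((J.sort).map fun j => sampleCre fun k => W k j).prod *ᵥ sampleVac d := by
  ext I
  rw [Matrix.mulVec_single_one]
  rfl

theorem sampleΓ_mulVec_vac (W : Matrix (Fin d) (Fin d) ℂ) :
    sampleΓ W *ᵥ sampleVac d = sampleVac d := by
  rw [sampleVac, sampleΓ_mulVec_single, Finset.sort_empty, List.map_nil, List.prod_nil,
    Matrix.one_mulVec, sampleVac]

theorem fCre_single (k : Fin d) (J : Finset (Fin d)) :
    fCre k (Pi.single J 1 : Finset (Fin d) → ℂ)
      = if k ∈ J then 0 else fermiSign k J • Pi.single (insert k J) 1 := by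
  ext I
  by_cases hk : k ∈ J
  · rw [if_pos hk]
    simp only [fCre, Pi.single_apply, Pi.zero_apply]
    split_ifs with h1 h2
    · exact absurd hk (h2 ▸ Finset.notMem_erase k I)
    · simp
    · rfl
  · rw [if_neg hk]
    simp only [fCre, Pi.single_apply, Pi.smul_apply, smul_eq_mul]
    by_cases h : I = insert k J
    · subst h
      rw [if_pos (Finset.mem_insert_self k J), Finset.erase_insert hk, fermiSign_insert_self]
      simp
    · rw [if_neg h, mul_zero]
      split_ifs with h1 h2
      · exact absurd (by rw [← h2, Finset.insert_erase h1]) h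
      · simp
      · rfl

theorem eq_of_mulVec_single {A B : SampleOp d}
    (h : ∀ J, A *ᵥ Pi.single J 1 = B *ᵥ Pi.single J 1) : A = B := by
  ext I J
  have := congrFun (h J) I
  simpa [Matrix.mulVec_single_one] using this

/-- `Γ(W) a_k^* = a^*(W e_k) Γ(W)`. -/
theorem sampleΓ_mul_cre (W : Matrix (Fin d) (Fin d) ℂ) (k : Fin d) :
    sampleΓ W * (sampleAnn k)ᴴ = (sampleCre fun l => W l k) * sampleΓ W := by
  refine eq_of_mulVec_single fun J => ?_
  rw [← Matrix.mulVec_mulVec, ← Matrix.mulVec_mulVec, sampleAnn_conjTranspose_mulVec,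
    sampleΓ_mulVec_single, Matrix.mulVec_mulVec, sampleCre_mul_prod_sort (fun j l => W l j),
    fCre_single]
  split_ifs with h
  · simp
  · rw [Matrix.mulVec_smul, sampleΓ_mulVec_single, Matrix.smul_mulVec]

/-- The vectors `a_{j₁}^* ⋯ a_{jₚ}^* Ω` determine an operator. -/
theorem eq_of_mulVec_cre_prod {A B : SampleOp d}
    (h : ∀ l : List (Fin d), A *ᵥ ((l.map fun j => (sampleAnn j)ᴴ).prod *ᵥ sampleVac d)
      = B *ᵥ ((l.map fun j => (sampleAnn j)ᴴ).prod *ᵥ sampleVac d)) : A = B := by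
  refine eq_of_mulVec_single fun J => ?_
  have key : ((J.sort).map fun j => (sampleAnn j)ᴴ).prod *ᵥ sampleVac d = Pi.single J 1 := by
    induction J using Finset.induction_on_min with
    | empty => rw [Finset.sort_empty, List.map_nil, List.prod_nil, Matrix.one_mulVec, sampleVac]
    | insert a J ha ih =>
      have haJ : a ∉ J := fun h => lt_irrefl _ (ha a h)
      rw [Finset.sort_insert _ (fun b hb => (ha b hb).le) haJ, List.map_cons, List.prod_cons,
        ← Matrix.mulVec_mulVec, ih, sampleAnn_conjTranspose_mulVec, fCre_single, if_neg haJ]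
      have hs : fermiSign a J = 1 := by
        unfold fermiSign
        rw [Finset.filter_eq_empty_iff.2]
        · simp
        · intro b hb
          exact (ha b hb).not_gt
      rw [hs, one_smul]
  rw [← key]
  exact h _

/-- `a_j Γ(W) = Γ(W) ∑ k, W_{jk} a_k`. -/
theorem sampleAnn_mul_sampleΓ (W : Matrix (Fin d) (Fin d) ℂ) (j : Fin d) :
    sampleAnn j * sampleΓ W = sampleΓ W * ∑ k, W j k • sampleAnn k := by
  refine eq_of_mulVec_cre_prod fun l => ?_
  induction l with
  | nil =>
    simp only [List.map_nil, List.prod_nil, Matrix.one_mulVec]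
    rw [← Matrix.mulVec_mulVec, ← Matrix.mulVec_mulVec, sampleΓ_mulVec_vac, sampleAnn_mulVec_vac,
      Matrix.sum_mulVec]
    simp [Matrix.smul_mulVec, sampleAnn_mulVec_vac]
  | cons k l ih =>
    rw [List.map_cons, List.prod_cons, ← Matrix.mulVec_mulVec (sampleVac d)]
    generalize (l.map fun j => (sampleAnn j)ᴴ).prod *ᵥ sampleVac d = x at ih ⊢
    have h1 : (∑ l, W j l • sampleAnn l) * (sampleAnn k)ᴴ
        = W j k • 1 - (sampleAnn k)ᴴ * ∑ l, W j l • sampleAnn l := by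
      rw [eq_sub_iff_add_eq]
      simp only [Finset.sum_mul, Finset.mul_sum, ← Finset.sum_add_distrib, mul_smul_comm,
        smul_mul_assoc, ← smul_add, sampleAnn_car]
      simp
    rw [Matrix.mulVec_mulVec x, Matrix.mulVec_mulVec x,
      mul_assoc, sampleΓ_mul_cre, ← mul_assoc, sampleAnn_mul_sampleCre, mul_assoc, h1, sub_mul, mul_sub,
      Matrix.sub_mulVec, Matrix.sub_mulVec, mul_assoc,
      ← Matrix.mulVec_mulVec x _ (sampleAnn j * sampleΓ W), ih,
      Matrix.mulVec_mulVec, ← mul_assoc, ← mul_assoc, sampleΓ_mul_cre]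
    congr 2
    simp

/-- The component at $I$ is the conjugate of the vacuum component of $\Gamma(W)e_I$, which vanishes
for $I\neq\emptyset$ because $\Gamma(W)e_I$ starts with a creation operator. -/
theorem sampleΓ_conjTranspose_mulVec_vac (W : Matrix (Fin d) (Fin d) ℂ) :
    (sampleΓ W)ᴴ *ᵥ sampleVac d = sampleVac d := by
  ext I
  rw [sampleVac, Matrix.mulVec_single_one]
  simp only [Matrix.col_apply, Matrix.conjTranspose_apply]
  induction I using Finset.induction_on_min with
  | empty => simp [sampleΓ, sampleVac]
  | insert a J ha _ =>
    have haJ : a ∉ J := fun h => lt_irrefl _ (ha a h)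
    rw [Pi.single_eq_of_ne (Finset.insert_ne_empty a J)]
    simp only [sampleΓ, Matrix.of_apply]
    rw [Finset.sort_insert _ (fun b hb => (ha b hb).le) haJ, List.map_cons, List.prod_cons,
      ← Matrix.mulVec_mulVec, sampleCre_mulVec_empty, star_zero]

/-- By the two intertwining relations and $W^*W=1$, the operator $\Gamma(W)^*\Gamma(W)$ commutes
with every $a_k^*$. It also fixes the vacuum, and the creation operators generate the Fock space
from it. -/
theorem sampleΓ_unitary {W : Matrix (Fin d) (Fin d) ℂ} (hW : Wᴴ * W = 1) :
    (sampleΓ W)ᴴ * sampleΓ W = 1 := by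
  have hstar : ∀ j, (sampleΓ W)ᴴ * (sampleAnn j)ᴴ
      = (∑ k, star (W j k) • (sampleAnn k)ᴴ) * (sampleΓ W)ᴴ := by
    intro j
    have := congrArg Matrix.conjTranspose (sampleAnn_mul_sampleΓ W j)
    simpa [Matrix.conjTranspose_mul, Matrix.conjTranspose_sum] using this
  have hcomm : ∀ k, (sampleΓ W)ᴴ * sampleΓ W * (sampleAnn k)ᴴ
      = (sampleAnn k)ᴴ * ((sampleΓ W)ᴴ * sampleΓ W) := by
    intro k
    rw [mul_assoc, sampleΓ_mul_cre, ← mul_assoc, ← mul_assoc]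
    congr 1
    simp only [sampleCre, Finset.mul_sum, mul_smul_comm, hstar, ← smul_mul_assoc,
      ← Finset.sum_mul]
    congr 1
    simp only [Finset.smul_sum, smul_smul]
    rw [Finset.sum_comm]
    have : ∀ m, ∑ l, (W l k * star (W l m)) • (sampleAnn m)ᴴ
        = (1 : Matrix (Fin d) (Fin d) ℂ) m k • (sampleAnn m)ᴴ := by
      intro m
      rw [← Finset.sum_smul, ← hW, Matrix.mul_apply]
      simp only [Matrix.conjTranspose_apply, mul_comm]
    simp only [this, Matrix.one_apply, ite_smul, one_smul, zero_smul]
    simp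
  refine eq_of_mulVec_cre_prod fun l => ?_
  induction l with
  | nil =>
    simp only [List.map_nil, List.prod_nil, Matrix.one_mulVec]
    rw [← Matrix.mulVec_mulVec, sampleΓ_mulVec_vac, sampleΓ_conjTranspose_mulVec_vac]
  | cons k l ih =>
    rw [List.map_cons, List.prod_cons, ← Matrix.mulVec_mulVec (sampleVac d),
      Matrix.mulVec_mulVec _ ((sampleΓ W)ᴴ * sampleΓ W), hcomm,
      ← Matrix.mulVec_mulVec, ih, Matrix.one_mulVec, Matrix.one_mulVec]

end Sample

/-! ### The reservoir -/

section Reservoir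

theorem resAnn_apply (j : ℤ) (f : ResFock) (I : Finset ℤ) :
    (resAnn j f : ResFock) I = fAnn j f I := by
  change (if j ∈ I then 0 else fermiSign j I) * f (insert j I) = _
  unfold fAnn
  split_ifs <;> simp

/-- A coordinate is an inner product with a basis vector $e_I$, so the adjoint is read off from
$b_je_I$, which is $\pm e_{I\setminus\{j\}}$ or zero. -/
theorem star_resAnn_apply (j : ℤ) (f : ResFock) (I : Finset ℤ) :
    (star (resAnn j) f : ResFock) I = fCre j f I := by
  have h1 : ∀ (g : ResFock) (J : Finset ℤ), g J = inner ℂ (lp.single 2 J (1 : ℂ)) g := by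
    intro g J
    rw [lp.inner_single_left]
    simp
  have h2 : resAnn j (lp.single 2 I (1 : ℂ))
      = if j ∈ I then fermiSign j I • (lp.single 2 (I.erase j) (1 : ℂ)) else 0 := by
    ext J
    rw [resAnn_apply]
    unfold fAnn
    by_cases hI : j ∈ I
    · rw [if_pos hI]
      simp only [lp.coeFn_smul, Pi.smul_apply, lp.single_apply, Pi.single_apply, smul_eq_mul]
      by_cases h : J = I.erase j
      · subst h
        simp [Finset.insert_erase hI, fermiSign_erase_self]
      · rw [if_neg h, mul_zero]
        split_ifs with h3 h4
        · rfl
        · exact absurd (by rw [← h4, Finset.erase_insert h3]) h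
        · simp
    · rw [if_neg hI]
      simp only [lp.coeFn_zero, Pi.zero_apply, lp.single_apply, Pi.single_apply]
      split_ifs with h3 h4
      · rfl
      · exact absurd (h4 ▸ Finset.mem_insert_self j J) hI
      · simp
  rw [h1, ContinuousLinearMap.star_eq_adjoint, ContinuousLinearMap.adjoint_inner_right, h2]
  unfold fCre
  split_ifs with h
  · rw [inner_smul_left, ← h1]
    congr 1
    exact star_fermiSign j I
  · rw [inner_zero_left]

theorem resAnn_anticomm (i j : ℤ) : resAnn i * resAnn j + resAnn j * resAnn i = 0 := by
  ext f I
  change (resAnn i (resAnn j f) : ResFock) I + (resAnn j (resAnn i f) : ResFock) I = 0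
  rw [resAnn_apply, resAnn_apply, ← fAnn_fAnn i j f I]
  congr 2 <;> (ext J; exact resAnn_apply _ _ _)

theorem resAnn_car (i j : ℤ) :
    resAnn i * star (resAnn j) + star (resAnn j) * resAnn i = if i = j then 1 else 0 := by
  ext f I
  have h : ((resAnn i * star (resAnn j) + star (resAnn j) * resAnn i) f : ResFock) I
      = fAnn i (fCre j f) I + fCre j (fAnn i f) I := by
    change (resAnn i (star (resAnn j) f) : ResFock) I + (star (resAnn j) (resAnn i f) : ResFock) I
      = _
    rw [resAnn_apply, star_resAnn_apply]
    congr 2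
    · ext J
      exact star_resAnn_apply _ _ _
    · ext J
      exact resAnn_apply _ _ _
  rw [h]
  split_ifs with hij
  · subst hij
    exact fAnn_fCre_self i f I
  · exact fAnn_fCre_of_ne hij f I

theorem star_resShift_mul_resAnn_mul_resShift (j : ℤ) :
    star resShift * resAnn j * resShift = resAnn (j + 1) := by
  rw [mul_assoc, resAnn_mul_resShift, ← mul_assoc, resShift_star_mul_self, one_mul]

end Reservoir

/-! ### The coupled system -/

section Total

variable {d : ℕ}

theorem tens_mul (B B' : ResFock →L[ℂ] ResFock) (A A' : SampleOp d) :
    tens B A * tens B' A' = tens (B * B') (A * A') := by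
  ext1 I J
  simp only [Matrix.mul_apply, tens, Matrix.of_apply, smul_mul_smul_comm, Finset.sum_smul]

theorem tens_conjTranspose (B : ResFock →L[ℂ] ResFock) (A : SampleOp d) :
    (tens B A)ᴴ = tens (star B) Aᴴ := by
  ext1 I J
  simp only [Matrix.conjTranspose_apply, tens, Matrix.of_apply, star_smul]

theorem tens_add_left (B B' : ResFock →L[ℂ] ResFock) (A : SampleOp d) :
    tens (B + B') A = tens B A + tens B' A := by
  ext1 I J
  simp only [Matrix.add_apply, tens, Matrix.of_apply, smul_add]

theorem tens_add_right (B : ResFock →L[ℂ] ResFock) (A A' : SampleOp d) :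
    tens B (A + A') = tens B A + tens B A' := by
  ext1 I J
  simp only [Matrix.add_apply, tens, Matrix.of_apply, add_smul]

theorem tens_smul_left (c : ℂ) (B : ResFock →L[ℂ] ResFock) (A : SampleOp d) :
    tens (c • B) A = c • tens B A := by
  ext1 I J
  simp only [Matrix.smul_apply, tens, Matrix.of_apply]
  exact smul_comm _ _ _

theorem tens_smul_right (c : ℂ) (B : ResFock →L[ℂ] ResFock) (A : SampleOp d) :
    tens B (c • A) = c • tens B A := by
  ext1 I J
  simp only [Matrix.smul_apply, tens, Matrix.of_apply, smul_assoc]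

theorem tens_zero_left (A : SampleOp d) : tens 0 A = 0 := by
  ext1 I J
  simp only [Matrix.zero_apply, tens, Matrix.of_apply, smul_zero]

theorem tens_zero_right (B : ResFock →L[ℂ] ResFock) : tens B (0 : SampleOp d) = 0 := by
  ext1 I J
  simp only [Matrix.zero_apply, tens, Matrix.of_apply, zero_smul]

theorem tens_one_one : tens 1 (1 : SampleOp d) = 1 := by
  ext1 I J
  simp only [Matrix.one_apply, tens, Matrix.of_apply, ite_smul, one_smul, zero_smul]

theorem tens_sum_left {κ : Type*} (s : Finset κ) (B : κ → ResFock →L[ℂ] ResFock)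
    (A : SampleOp d) : tens (∑ k ∈ s, B k) A = ∑ k ∈ s, tens (B k) A := by
  classical
  induction s using Finset.induction_on with
  | empty => simp [tens_zero_left]
  | insert a s ha ih => rw [Finset.sum_insert ha, Finset.sum_insert ha, tens_add_left, ih]

theorem tens_sum_right {κ : Type*} (s : Finset κ) (B : ResFock →L[ℂ] ResFock)
    (A : κ → SampleOp d) : tens B (∑ k ∈ s, A k) = ∑ k ∈ s, tens B (A k) := by
  classical
  induction s using Finset.induction_on with
  | empty => simp [tens_zero_right]
  | insert a s ha ih => rw [Finset.sum_insert ha, Finset.sum_insert ha, tens_add_right, ih]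

variable [NeZero d]

/-- The generator `b_0^* ⊗ a_0 + b_0 ⊗ a_0^*` of the coupling. -/
def couplingGen (d : ℕ) [NeZero d] : TotalOp d :=
  tens (star (resAnn 0)) (sampleAnn (0 : Fin d)) + tens (resAnn 0) (sampleAnn (0 : Fin d))ᴴ

theorem coupling_eq (α : ℝ) :
    coupling d α = NormedSpace.exp ((-(Complex.I * (α : ℂ))) • couplingGen d) := rfl

theorem couplingGen_conjTranspose : (couplingGen d)ᴴ = couplingGen d := by
  rw [couplingGen, Matrix.conjTranspose_add, tens_conjTranspose, tens_conjTranspose, star_star,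
    Matrix.conjTranspose_conjTranspose, add_comm]

/-- As the tensor factors commute, the anticommutator acts on the sample factor alone, where the
canonical anticommutation relations collapse it to a multiple of the identity. A commutator would
leave quadratic terms. -/
theorem couplingGen_anticomm_sample (j : Fin d) :
    couplingGen d * tens 1 (sampleAnn j) + tens 1 (sampleAnn j) * couplingGen d
      = if j = 0 then tens (resAnn 0) 1 else 0 := by
  simp only [couplingGen, add_mul, mul_add, tens_mul, one_mul, mul_one]
  have h1 := sampleAnn_anticomm (0 : Fin d) j
  have h2 := sampleAnn_car j (0 : Fin d)
  calc _ = tens (star (resAnn 0)) (sampleAnn 0 * sampleAnn j + sampleAnn j * sampleAnn 0)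
        + tens (resAnn 0) (sampleAnn j * (sampleAnn 0)ᴴ + (sampleAnn 0)ᴴ * sampleAnn j) := by
        rw [tens_add_right, tens_add_right]
        abel
    _ = _ := by
        rw [h1, h2, tens_zero_right, zero_add]
        split_ifs
        · rfl
        · exact tens_zero_right _

theorem couplingGen_anticomm_res (m : ℤ) :
    couplingGen d * tens (resAnn m) 1 + tens (resAnn m) 1 * couplingGen d
      = if m = 0 then tens 1 (sampleAnn 0) else 0 := by
  simp only [couplingGen, add_mul, mul_add, tens_mul, one_mul, mul_one]
  have h1 := resAnn_anticomm 0 m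
  have h2 := resAnn_car m 0
  calc _ = tens (resAnn 0 * resAnn m + resAnn m * resAnn 0) (sampleAnn (0 : Fin d))ᴴ
        + tens (resAnn m * star (resAnn 0) + star (resAnn 0) * resAnn m)
          (sampleAnn (0 : Fin d)) := by
        rw [tens_add_left, tens_add_left]
        abel
    _ = _ := by
        rw [h1, h2, tens_zero_left, zero_add]
        split_ifs
        · rfl
        · exact tens_zero_left _

attribute [local instance] Matrix.linftyOpNormedRing Matrix.linftyOpNormedAlgebra

theorem coupling_mul_coupling_neg (α : ℝ) : coupling d α * coupling d (-α) = 1 := by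
  let : NormedAlgebra ℚ (ResFock →L[ℂ] ResFock) := NormedAlgebra.restrictScalars ℚ ℂ _
  rw [coupling_eq, coupling_eq, ← Matrix.exp_add_of_commute, ← add_smul]
  · simp
  · exact ((Commute.refl _).smul_left _).smul_right _

theorem coupling_conjTranspose (α : ℝ) : (coupling d α)ᴴ = coupling d (-α) := by
  rw [coupling_eq, coupling_eq, ← Matrix.exp_conjTranspose, Matrix.conjTranspose_smul,
    couplingGen_conjTranspose]
  simp

theorem coupling_conjTranspose_mul_self (α : ℝ) : (coupling d α)ᴴ * coupling d α = 1 := by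
  have := coupling_mul_coupling_neg (d := d) (-α)
  rwa [neg_neg, ← coupling_conjTranspose] at this

theorem coupling_mul_conjTranspose_self (α : ℝ) : coupling d α * (coupling d α)ᴴ = 1 := by
  rw [coupling_conjTranspose, coupling_mul_coupling_neg]

/-- An operator that satisfies `H x + x H = z x` for the generator `H` is multiplied by a phase. -/
theorem coupling_conj_of_anticomm (α : ℝ) {x : TotalOp d} {z : ℂ}
    (h : couplingGen d * x + x * couplingGen d = z • x) :
    coupling d α * x * coupling d α = Complex.exp (-(Complex.I * α) * z) • x := by
  let : NormedAlgebra ℚ (ResFock →L[ℂ] ResFock) := NormedAlgebra.restrictScalars ℚ ℂ _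
  let : NormedAlgebra ℚ (TotalOp d) := NormedAlgebra.restrictScalars ℚ ℂ _
  -- The hypothesis reads $xH=(z-H)x$. Exponentiating gives $xK=e^{-i\alpha z}K^{-1}x$, and
  -- multiplication by $K$ on the left cancels $K^{-1}$.
  have hs : SemiconjBy x ((-(Complex.I * (α : ℂ))) • couplingGen d)
      ((-(Complex.I * (α : ℂ))) • (algebraMap ℂ (TotalOp d) z - couplingGen d)) := by
    rw [SemiconjBy, mul_smul_comm, smul_mul_assoc, sub_mul, ← Algebra.smul_def, ← h,
      add_sub_cancel_left]
  have : @CompleteSpace (TotalOp d) PseudoMetricSpace.toUniformSpace :=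
    inferInstanceAs (CompleteSpace (Finset (Fin d) → Finset (Fin d) → ResFock →L[ℂ] ResFock))
  have h2 : SemiconjBy x (coupling d α) (NormedSpace.exp ((-(Complex.I * (α : ℂ))) •
      (algebraMap ℂ (TotalOp d) z - couplingGen d))) := hs.exp_right
  have h3 : NormedSpace.exp ((-(Complex.I * (α : ℂ))) • (algebraMap ℂ (TotalOp d) z
      - couplingGen d)) = Complex.exp (-(Complex.I * α) * z) • coupling d (-α) := by
    rw [smul_sub, sub_eq_add_neg, Matrix.exp_add_of_commute]
    · rw [← smul_one_mul (Complex.exp (-(Complex.I * α) * z)) (coupling d (-α))]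
      congr 1
      · rw [← Algebra.algebraMap_eq_smul_one, Complex.exp_eq_exp_ℂ,
          NormedSpace.algebraMap_exp_comm, map_mul, ← Algebra.smul_def]
        rfl
      · rw [coupling_eq]
        simp
    · refine Commute.neg_right (Commute.smul_left (Commute.smul_right ?_ _) _)
      exact Algebra.commutes _ _
  rw [mul_assoc, h2.eq, h3, smul_mul_assoc, mul_smul_comm, ← mul_assoc,
    coupling_mul_coupling_neg, one_mul]

end Total

/-! ### The time evolution of linear observables -/

section Evolution

variable {d : ℕ}

theorem half_phase_sum (α : ℝ) (x y : TotalOp d) :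
    (2⁻¹ : ℂ) • (Complex.exp (-(Complex.I * α) * 1) • (x + y)
      + Complex.exp (-(Complex.I * α) * (-1)) • (x - y))
      = (Real.cos α : ℂ) • x - (Complex.I * Real.sin α) • y := by
  have h1 : Complex.exp (-(Complex.I * α) * 1) = Real.cos α - Complex.I * Real.sin α := by
    rw [show -(Complex.I * (α : ℂ)) * 1 = ((-α : ℝ) : ℂ) * Complex.I by push_cast; ring,
      Complex.exp_mul_I]
    simp only [← Complex.ofReal_cos, ← Complex.ofReal_sin, Real.cos_neg, Real.sin_neg]
    push_cast
    ring
  have h2 : Complex.exp (-(Complex.I * α) * (-1)) = Real.cos α + Complex.I * Real.sin α := by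
    rw [show -(Complex.I * (α : ℂ)) * (-1) = (α : ℂ) * Complex.I by ring, Complex.exp_mul_I]
    simp only [← Complex.ofReal_cos, ← Complex.ofReal_sin]
    ring
  rw [h1, h2]
  module

theorem tens_step_unitary {W : Matrix (Fin d) (Fin d) ℂ} (hW : Wᴴ * W = 1) :
    tens resShift (sampleΓ W) * (tens resShift (sampleΓ W))ᴴ = 1 := by
  rw [tens_conjTranspose, tens_mul, resShift_mul_star_self,
    mul_eq_one_comm.1 (sampleΓ_unitary hW), tens_one_one]

/-- The linear combination `∑ k, u_k a_k` of annihilation operators. -/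
def sampleLin (u : Fin d → ℂ) : SampleOp d := ∑ k, u k • sampleAnn k

/-- The linear combination `∑_{m < t} r_m b_m` of annihilation operators. -/
def resLin (t : ℕ) (r : ℕ → ℂ) : ResFock →L[ℂ] ResFock :=
  ∑ m ∈ Finset.range t, r m • resAnn m

variable [NeZero d]

/-- The anticommutator with the generator exchanges `x` and `y`, so $x\pm y$ are eigenvectors for
$\pm1$ and acquire the phases $e^{\mp i\alpha}$; `x` is half their sum. -/
theorem coupling_conj_pair (α : ℝ) {x y : TotalOp d}
    (hx : couplingGen d * x + x * couplingGen d = y)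
    (hy : couplingGen d * y + y * couplingGen d = x) :
    coupling d α * x * coupling d α
      = (Real.cos α : ℂ) • x - (Complex.I * Real.sin α) • y := by
  have h1 := coupling_conj_of_anticomm α (x := x + y) (z := 1) (by
    rw [mul_add, add_mul, add_add_add_comm, hx, hy, one_smul, add_comm])
  have h2 := coupling_conj_of_anticomm α (x := x - y) (z := -1) (by
    rw [mul_sub, sub_mul, ← add_sub_add_comm, hx, hy, neg_one_smul, neg_sub])
  rw [← half_phase_sum, ← h1, ← h2, ← add_mul, ← mul_add, ← smul_mul_assoc, ← mul_smul_comm]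
  congr 2
  module

theorem coupling_conj_sample (α : ℝ) (j : Fin d) :
    coupling d α * tens 1 (sampleAnn j) * coupling d α
      = (if j = 0 then (Real.cos α : ℂ) else 1) • tens 1 (sampleAnn j)
        - (if j = 0 then Complex.I * Real.sin α else 0) • tens (resAnn 0) 1 := by
  by_cases h : j = 0
  · subst h
    simp only [if_true]
    refine coupling_conj_pair α ?_ ?_
    · simpa using couplingGen_anticomm_sample (0 : Fin d)
    · simpa using couplingGen_anticomm_res (d := d) 0
  · have := coupling_conj_of_anticomm α (x := tens 1 (sampleAnn j)) (z := 0)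
      (by rw [couplingGen_anticomm_sample, if_neg h, zero_smul])
    simpa [h] using this

theorem coupling_conj_res (α : ℝ) {m : ℤ} (hm : m ≠ 0) :
    coupling d α * tens (resAnn m) 1 * coupling d α = tens (resAnn m) 1 := by
  have := coupling_conj_of_anticomm α (x := tens (d := d) (resAnn m) 1) (z := 0)
    (by rw [couplingGen_anticomm_res, if_neg hm, zero_smul])
  simpa using this

/-- One step of the evolution of linear observables. -/
def linStep (W : Matrix (Fin d) (Fin d) ℂ) (α : ℝ) (x : TotalOp d) : TotalOp d :=
  coupling d α * ((tens resShift (sampleΓ W))ᴴ * x * tens resShift (sampleΓ W)) * coupling d α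

/-- The contraction `W D`, with `D = diag (cos α, 1, ..., 1)`. -/
def damped (W : Matrix (Fin d) (Fin d) ℂ) (α : ℝ) : Matrix (Fin d) (Fin d) ℂ :=
  W * Matrix.diagonal fun k => if k = 0 then (Real.cos α : ℂ) else 1

/-- The reservoir coefficients of the evolved annihilation operator `a_j`. -/
def resCoef (W : Matrix (Fin d) (Fin d) ℂ) (α : ℝ) (j : Fin d) : ℕ → ℕ → ℂ
  | 0, _ => 0
  | t + 1, 0 => -(Complex.I * Real.sin α) * (damped W α ^ t * W) j 0
  | t + 1, m + 1 => resCoef W α j t m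

/-- The shift carries $b_m$ to $b_{m+1}$, which the coupling leaves alone since it only touches
$b_0$. After rotation by $W$, only the component along $a_0$ is split, into $\cos\alpha\,a_0$ and
$-i\sin\alpha\,b_0$; the latter fills the slot vacated by the shift. -/
theorem linStep_lin {W : Matrix (Fin d) (Fin d) ℂ} (hW : Wᴴ * W = 1) (α : ℝ) (t : ℕ)
    (u : Fin d → ℂ) (r r' : ℕ → ℂ) (h0 : r' 0 = -(Complex.I * Real.sin α) * (u ᵥ* W) 0)
    (hs : ∀ m, r' (m + 1) = r m) :
    linStep W α (tens 1 (sampleLin u) + tens (resLin t r) 1)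
      = tens 1 (sampleLin (u ᵥ* damped W α)) + tens (resLin (t + 1) r') 1 := by
  have h1 : (sampleΓ W)ᴴ * sampleLin u * sampleΓ W = sampleLin (u ᵥ* W) := by
    rw [mul_assoc, sampleLin, Finset.sum_mul]
    simp only [smul_mul_assoc, sampleAnn_mul_sampleΓ]
    simp only [← mul_smul_comm, ← Finset.mul_sum]
    rw [← mul_assoc, sampleΓ_unitary hW, one_mul]
    simp only [sampleLin, Finset.smul_sum, smul_smul, Matrix.vecMul, dotProduct, Finset.sum_smul]
    exact Finset.sum_comm
  have h2 : star resShift * resLin t r * resShift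
      = ∑ m ∈ Finset.range t, r m • resAnn ((m + 1 : ℕ) : ℤ) := by
    simp only [resLin, Finset.mul_sum, Finset.sum_mul, mul_smul_comm, smul_mul_assoc,
      star_resShift_mul_resAnn_mul_resShift]
    rfl
  have h3 : (tens resShift (sampleΓ W))ᴴ * (tens 1 (sampleLin u) + tens (resLin t r) 1)
      * tens resShift (sampleΓ W) = tens 1 (sampleLin (u ᵥ* W))
        + tens (∑ m ∈ Finset.range t, r m • resAnn ((m + 1 : ℕ) : ℤ)) 1 := by
    rw [tens_conjTranspose, mul_add, add_mul, tens_mul, tens_mul, tens_mul, tens_mul, h1, h2,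
      mul_one, mul_one, resShift_star_mul_self, sampleΓ_unitary hW]
  have h4 : coupling d α * tens 1 (sampleLin (u ᵥ* W)) * coupling d α
      = tens 1 (sampleLin (u ᵥ* damped W α)) + r' 0 • tens (resAnn 0) 1 := by
    rw [sampleLin, tens_sum_right, Finset.mul_sum, Finset.sum_mul]
    simp only [tens_smul_right, mul_smul_comm, smul_mul_assoc, coupling_conj_sample, smul_sub,
      Finset.sum_sub_distrib]
    rw [sub_eq_add_neg, sampleLin, tens_sum_right]
    congr 1
    · refine Finset.sum_congr rfl fun k _ => ?_
      rw [tens_smul_right, smul_smul, damped, ← Matrix.vecMul_vecMul, Matrix.vecMul_diagonal]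
    · rw [h0]
      simp only [ite_smul, zero_smul, smul_ite, smul_zero, Finset.sum_ite_eq', Finset.mem_univ,
        if_true, smul_smul]
      rw [← neg_smul]
      congr 1
      ring
  have h5 : coupling d α * tens (∑ m ∈ Finset.range t, r m • resAnn ((m + 1 : ℕ) : ℤ)) 1
      * coupling d α = tens (∑ m ∈ Finset.range t, r m • resAnn ((m + 1 : ℕ) : ℤ)) 1 := by
    rw [tens_sum_left, Finset.mul_sum, Finset.sum_mul]
    refine Finset.sum_congr rfl fun m _ => ?_
    rw [tens_smul_left, mul_smul_comm, smul_mul_assoc, coupling_conj_res]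
    exact_mod_cast Nat.succ_ne_zero m
  rw [linStep, h3, mul_add, add_mul, h4, h5, add_assoc, ← tens_smul_left, ← tens_add_left, resLin,
    Finset.sum_range_succ', add_comm (r' 0 • _)]
  simp only [hs]
  rfl

theorem linStep_iterate {W : Matrix (Fin d) (Fin d) ℂ} (hW : Wᴴ * W = 1) (α : ℝ) (j : Fin d)
    (t : ℕ) : (linStep W α)^[t] (tens 1 (sampleAnn j))
      = tens 1 (sampleLin ((damped W α ^ t) j)) + tens (resLin t (resCoef W α j t)) 1 := by
  induction t with
  | zero =>
    simp [resLin, tens_zero_left, sampleLin, Matrix.one_apply]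
  | succ t ih =>
    rw [Function.iterate_succ_apply', ih, linStep_lin hW α t _ _ (resCoef W α j (t + 1))]
    · rw [pow_succ]
      rfl
    · rfl
    · intro m
      rfl

/-- With $V=\Gamma(S)\otimes\Gamma(W)$, the extra coupling in `linStep` disappears from the product:
$(KV^*xVK)^*(KV^*yVK)=K^*V^*x^*yVK$, using $K^*K=1$ and $VV^*=1$. -/
theorem evol_conjTranspose_mul {W : Matrix (Fin d) (Fin d) ℂ} (hW : Wᴴ * W = 1) (α : ℝ) (t : ℕ)
    (x y : TotalOp d) :
    evol W α t (xᴴ * y) = ((linStep W α)^[t] x)ᴴ * (linStep W α)^[t] y := by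
  induction t generalizing x y with
  | zero => simp [evol]
  | succ t ih =>
    have h : (stepU W α)ᴴ * (xᴴ * y) * stepU W α = (linStep W α x)ᴴ * linStep W α y := by
      have h1 := tens_step_unitary hW
      have h2 := coupling_conjTranspose_mul_self (d := d) α
      simp only [linStep, stepU, Matrix.conjTranspose_mul, Matrix.conjTranspose_conjTranspose]
      generalize tens resShift (sampleΓ W) = V at h1 ⊢
      generalize coupling d α = K at h2 ⊢
      calc Kᴴ * Vᴴ * (xᴴ * y) * (V * K) = Kᴴ * Vᴴ * xᴴ * 1 * y * V * K := by
            simp only [mul_assoc, one_mul]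
        _ = Kᴴ * Vᴴ * xᴴ * V * 1 * Vᴴ * y * V * K := by
            rw [mul_one (_ * V), mul_assoc _ V Vᴴ, h1]
        _ = _ := by
            rw [← h2]
            simp only [mul_assoc]
    rw [Function.iterate_succ_apply, Function.iterate_succ_apply, ← ih, ← h]
    simp only [evol]
    rw [pow_succ, pow_succ']
    simp only [mul_assoc]

theorem stepU_pow_mul_conjTranspose {W : Matrix (Fin d) (Fin d) ℂ} (hW : Wᴴ * W = 1) (α : ℝ)
    (t : ℕ) : stepU W α ^ t * (stepU W α)ᴴ ^ t = 1 := by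
  have h : stepU W α * (stepU W α)ᴴ = 1 := by
    rw [stepU, Matrix.conjTranspose_mul, mul_assoc, ← mul_assoc (coupling d α),
      coupling_mul_conjTranspose_self, one_mul, tens_step_unitary hW]
  induction t with
  | zero => simp
  | succ t ih =>
    rw [pow_succ, pow_succ', mul_assoc, ← mul_assoc (stepU W α), h, one_mul, ih]

theorem evol_mul {W : Matrix (Fin d) (Fin d) ℂ} (hW : Wᴴ * W = 1) (α : ℝ) (t : ℕ)
    (X Y : TotalOp d) : evol W α t (X * Y) = evol W α t X * evol W α t Y := by
  calc evol W α t (X * Y) = (stepU W α)ᴴ ^ t * X * 1 * Y * stepU W α ^ t := by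
        simp only [evol, mul_assoc, one_mul]
    _ = _ := by
        rw [← stepU_pow_mul_conjTranspose hW α t]
        simp only [evol, mul_assoc]

/-- The Gram matrix of the reservoir coefficients. -/
def resGram (W : Matrix (Fin d) (Fin d) ℂ) (α : ℝ) (t : ℕ) (i j : Fin d) : ℂ :=
  ∑ m ∈ Finset.range t, star (resCoef W α i t m) * resCoef W α j t m

/-- Amplitude is conserved. Write $M$ for `damped W α` and $N=M^tW$: unitarity gives
$M^t(M^t)^*=NN^*$, and $M^{t+1}$ is $N$ with column $0$ multiplied by $\cos\alpha$. What is lost in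
that column is the factor $\sin^2\alpha$ gained by the new reservoir coefficient. The indices are
swapped because `resGram` conjugates its first argument. -/
theorem resGram_eq {W : Matrix (Fin d) (Fin d) ℂ} (hW : Wᴴ * W = 1) (α : ℝ) (t : ℕ)
    (i j : Fin d) :
    resGram W α t i j = (1 - damped W α ^ t * (damped W α ^ t)ᴴ) j i := by
  have hcs : (Real.sin α : ℂ) * Real.sin α = 1 - Real.cos α * Real.cos α := by
    rw [eq_sub_iff_add_eq]
    exact_mod_cast (by nlinarith [Real.sin_sq_add_cos_sq α] :
      Real.sin α * Real.sin α + Real.cos α * Real.cos α = 1)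
  induction t with
  | zero => simp [resGram]
  | succ t ih =>
    have h1 : resGram W α (t + 1) i j = resGram W α t i j
        + star (resCoef W α i (t + 1) 0) * resCoef W α j (t + 1) 0 := by
      rw [resGram, Finset.sum_range_succ']
      rfl
    have h2 : damped W α ^ t * (damped W α ^ t)ᴴ
        = (damped W α ^ t * W) * (damped W α ^ t * W)ᴴ := by
      rw [Matrix.conjTranspose_mul, mul_assoc _ W, ← mul_assoc W, mul_eq_one_comm.1 hW, one_mul]
    have h3 : damped W α ^ (t + 1) = damped W α ^ t * W
        * Matrix.diagonal fun k => if k = 0 then (Real.cos α : ℂ) else 1 := by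
      rw [pow_succ, mul_assoc]
      rfl
    rw [h1, ih, h2, h3, Matrix.sub_apply, Matrix.sub_apply, sub_add, sub_right_inj]
    simp only [resCoef]
    generalize damped W α ^ t * W = N
    rw [Matrix.mul_apply, Matrix.mul_apply, ← Finset.add_sum_erase _ _ (Finset.mem_univ (0 : Fin d)),
      ← Finset.add_sum_erase _ _ (Finset.mem_univ (0 : Fin d))]
    have h4 : ∀ k ∈ Finset.univ.erase (0 : Fin d),
        (N * Matrix.diagonal (fun k => if k = 0 then (Real.cos α : ℂ) else 1) : Matrix _ _ ℂ) j k
          * (N * Matrix.diagonal (fun k => if k = 0 then (Real.cos α : ℂ) else 1) : Matrix _ _ ℂ)ᴴ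
            k i
        = N j k * Nᴴ k i := by
      intro k hk
      have hk0 := Finset.ne_of_mem_erase hk
      simp [Matrix.mul_diagonal, hk0]
    rw [Finset.sum_congr rfl h4]
    simp only [Matrix.mul_diagonal, Matrix.conjTranspose_apply, if_true, star_mul', star_neg,
      RCLike.star_def, Complex.conj_I, Complex.conj_ofReal]
    linear_combination (-(starRingEnd ℂ) (N i 0) * N j 0) * hcs
      + (Real.sin α : ℂ) * Real.sin α * (starRingEnd ℂ) (N i 0) * N j 0 * Complex.I_mul_I

end Evolution

/-! ### Expectations of monomials in the quasi-free state -/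

section QuasiFree

theorem resB_car (i j : ℤ) :
    resB i * star (resB j) = (if i = j then 1 else 0) - star (resB j) * resB i := by
  rw [eq_sub_iff_add_eq]
  apply Subtype.ext
  have : ((if i = j then 1 else 0 : resAlg) : ResFock →L[ℂ] ResFock) = if i = j then 1 else 0 := by
    split_ifs <;> rfl
  rw [this]
  exact resAnn_car i j

/-- The linear combination `∑_{m < t} r_m b_m` as an element of `𝓑`. -/
def algLin (t : ℕ) (r : ℕ → ℂ) : resAlg := ∑ m ∈ Finset.range t, r m • resB m

theorem coe_algLin (t : ℕ) (r : ℕ → ℂ) : (algLin t r : ResFock →L[ℂ] ResFock) = resLin t r := by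
  rw [algLin, AddSubmonoidClass.coe_finsetSum]
  rfl

theorem star_algLin (t : ℕ) (r : ℕ → ℂ) :
    star (algLin t r) = ∑ m ∈ Finset.range t, star (r m) • star (resB m) := by
  simp only [algLin, star_sum, star_smul]

/-- The inner product of two coefficient sequences. -/
def gram (t : ℕ) (r r' : ℕ → ℂ) : ℂ := ∑ m ∈ Finset.range t, star (r m) * r' m

theorem algLin_mul_star (t : ℕ) (r r' : ℕ → ℂ) :
    algLin t r * star (algLin t r') = gram t r' r • 1 - star (algLin t r') * algLin t r := by
  simp only [star_algLin]
  simp only [algLin, Finset.sum_mul, Finset.mul_sum, smul_mul_smul_comm, resB_car,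
    smul_sub, Finset.sum_sub_distrib]
  congr 1
  · simp only [gram, Nat.cast_inj, smul_ite, smul_zero, Finset.sum_smul]
    refine Finset.sum_congr rfl fun i hi => ?_
    rw [Finset.sum_ite_eq', if_pos hi, mul_comm]
  · rw [Finset.sum_comm]
    simp only [mul_comm]

variable {σ : ℝ} {ω : resAlg →ₗ[ℂ] ℂ}

section Monomials

variable (hq : IsQuasiFree ((σ : ℂ) • (1 : Matrix ℤ ℤ ℂ)) ω)
include hq

theorem state_b (q : ℤ) : ω (resB q) = 0 := by
  simpa using hq.2 0 1 ![] ![q] (by norm_num)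

theorem state_bs (p : ℤ) : ω (star (resB p)) = 0 := by
  simpa using hq.2 1 0 ![p] ![] (by norm_num)

theorem state_b_b (q q' : ℤ) : ω (resB q * resB q') = 0 := by
  simpa using hq.2 0 2 ![] ![q, q'] (by norm_num)

theorem state_bs_bs (p p' : ℤ) : ω (star (resB p) * star (resB p')) = 0 := by
  simpa using hq.2 2 0 ![p', p] ![] (by norm_num)

theorem state_bs_b (p q : ℤ) : ω (star (resB p) * resB q) = if p = q then (σ : ℂ) else 0 := by
  simpa [Matrix.one_apply, eq_comm] using hq.1 1 ![p] ![q]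

theorem state_bs_b_b (p q q' : ℤ) : ω (star (resB p) * (resB q * resB q')) = 0 := by
  simpa using hq.2 1 2 ![p] ![q, q'] (by norm_num)

theorem state_bs_bs_b (p p' q : ℤ) : ω (star (resB p) * (star (resB p') * resB q)) = 0 := by
  simpa [mul_assoc] using hq.2 2 1 ![p', p] ![q] (by norm_num)

theorem state_bs_bs_b_b (p p' q q' : ℤ) :
    ω (star (resB p) * (star (resB p') * (resB q * resB q')))
      = (σ : ℂ) ^ 2 * ((if p' = q then 1 else 0) * (if p = q' then 1 else 0)
        - (if p = q then 1 else 0) * (if p' = q' then 1 else 0)) := by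
  -- `IsQuasiFree` multiplies the creation operators in reverse order of their index, hence `![p',
  -- p]`.
  have h := hq.1 2 ![p', p] ![q, q']
  simp only [Matrix.det_fin_two, Matrix.of_apply, Matrix.smul_apply, Matrix.one_apply,
    smul_eq_mul, Matrix.cons_val_zero, Matrix.cons_val_one, List.ofFn_succ, List.ofFn_zero,
    Fin.succ_zero_eq_one, List.reverse_cons, List.reverse_nil, List.nil_append, List.cons_append,
    List.prod_cons, List.prod_nil, mul_one, mul_assoc] at h
  rw [h]
  simp only [eq_comm (a := q), eq_comm (a := q')]
  ring

theorem state_algLin (t : ℕ) (r : ℕ → ℂ) : ω (algLin t r) = 0 := by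
  simp [algLin, state_b hq]

theorem state_star_algLin (t : ℕ) (r : ℕ → ℂ) : ω (star (algLin t r)) = 0 := by
  simp [star_algLin, state_bs hq]

theorem state_algLin_algLin (t : ℕ) (r r' : ℕ → ℂ) : ω (algLin t r * algLin t r') = 0 := by
  simp [algLin, Finset.sum_mul, Finset.mul_sum, state_b_b hq]

theorem state_star_star (t : ℕ) (r r' : ℕ → ℂ) :
    ω (star (algLin t r) * star (algLin t r')) = 0 := by
  simp [star_algLin, Finset.sum_mul, Finset.mul_sum, state_bs_bs hq]

theorem state_star_algLin_algLin (t : ℕ) (r r' : ℕ → ℂ) :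
    ω (star (algLin t r) * algLin t r') = σ * gram t r r' := by
  simp only [star_algLin]
  simp only [algLin, gram, Finset.sum_mul, Finset.mul_sum, smul_mul_smul_comm,
    map_sum, map_smul, state_bs_b hq, Nat.cast_inj, smul_eq_mul, mul_ite, mul_zero]
  rw [Finset.sum_comm]
  refine Finset.sum_congr rfl fun i hi => ?_
  rw [Finset.sum_ite_eq, if_pos hi]
  ring

theorem state_star_algLin_algLin_algLin (t : ℕ) (r₁ r₂ r₃ : ℕ → ℂ) :
    ω (star (algLin t r₁) * (algLin t r₂ * algLin t r₃)) = 0 := by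
  simp only [star_algLin]
  simp [algLin, Finset.sum_mul, Finset.mul_sum, state_bs_b_b hq]

theorem state_star_star_algLin (t : ℕ) (r₁ r₂ r₃ : ℕ → ℂ) :
    ω (star (algLin t r₁) * (star (algLin t r₂) * algLin t r₃)) = 0 := by
  simp only [star_algLin]
  simp [algLin, Finset.sum_mul, Finset.mul_sum, state_bs_bs_b hq]

theorem state_bs_bs_algLin_algLin {t p p' : ℕ} (hp : p ∈ Finset.range t)
    (hp' : p' ∈ Finset.range t) (r r' : ℕ → ℂ) :
    ω (star (resB p) * (star (resB p') * (algLin t r * algLin t r')))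
      = (σ : ℂ) ^ 2 * (r p' * r' p - r p * r' p') := by
  have h : ∀ l m : ℕ, r l * (r' m * ((σ : ℂ) ^ 2 * ((if p' = l then 1 else 0)
      * (if p = m then 1 else 0) - (if p = l then 1 else 0) * (if p' = m then 1 else 0))))
      = (σ : ℂ) ^ 2 * ((if p' = l then r l else 0) * (if p = m then r' m else 0)
        - (if p = l then r l else 0) * (if p' = m then r' m else 0)) := by
    intro l m
    split_ifs <;> ring
  simp only [algLin, Finset.sum_mul, Finset.mul_sum, smul_mul_assoc, mul_smul_comm,
    map_sum, map_smul, state_bs_bs_b_b hq, Nat.cast_inj, smul_eq_mul]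
  rw [Finset.sum_comm]
  simp only [mul_left_comm (r' _) (r _), h, ← Finset.mul_sum, Finset.sum_sub_distrib,
    ← Finset.sum_mul]
  simp only [Finset.sum_ite_eq, hp, hp', if_true]

theorem state_star_star_algLin_algLin (t : ℕ) (r₁ r₂ r₃ r₄ : ℕ → ℂ) :
    ω (star (algLin t r₁) * (star (algLin t r₂) * (algLin t r₃ * algLin t r₄)))
      = (σ : ℂ) ^ 2 * (gram t r₂ r₃ * gram t r₁ r₄ - gram t r₁ r₃ * gram t r₂ r₄) := by
  simp only [star_algLin, Finset.sum_mul, Finset.mul_sum, smul_mul_assoc, mul_smul_comm,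
    map_sum, map_smul]
  calc _ = ∑ p' ∈ Finset.range t, ∑ p ∈ Finset.range t, (σ : ℂ) ^ 2 *
        (star (r₂ p') * r₃ p' * (star (r₁ p) * r₄ p)
          - star (r₁ p) * r₃ p * (star (r₂ p') * r₄ p')) := by
        refine Finset.sum_congr rfl fun p' hp' => ?_
        rw [smul_eq_mul, Finset.mul_sum]
        refine Finset.sum_congr rfl fun p hp => ?_
        simp only [state_bs_bs_algLin_algLin hq hp hp', smul_eq_mul]
        ring
    _ = _ := by
        simp only [← Finset.mul_sum, Finset.sum_sub_distrib, ← Finset.sum_mul]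
        rfl

theorem state_algLin_star (hω : ω 1 = 1) (t : ℕ) (r r' : ℕ → ℂ) :
    ω (algLin t r * star (algLin t r')) = (1 - σ) * gram t r' r := by
  rw [algLin_mul_star, map_sub, map_smul, hω, state_star_algLin_algLin hq, smul_eq_mul]
  ring

theorem state_star_algLin_star (t : ℕ) (r₁ r₂ r₃ : ℕ → ℂ) :
    ω (star (algLin t r₁) * (algLin t r₂ * star (algLin t r₃))) = 0 := by
  rw [algLin_mul_star, mul_sub, map_sub, mul_smul_comm, map_smul, mul_one, state_star_algLin hq,
    state_star_star_algLin hq]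
  simp

theorem state_algLin_star_algLin (t : ℕ) (r₁ r₂ r₃ : ℕ → ℂ) :
    ω (algLin t r₁ * (star (algLin t r₂) * algLin t r₃)) = 0 := by
  rw [← mul_assoc, algLin_mul_star, sub_mul, map_sub, smul_mul_assoc, map_smul, one_mul,
    state_algLin hq, mul_assoc, state_star_algLin_algLin_algLin hq]
  simp

/-- Normal ordering the two middle factors leaves the contraction $g_{32}$ times a two-point
function $\sigma g_{14}$, minus a normally ordered four-point function
$\sigma^2(g_{32}g_{14}-g_{12}g_{34})$. -/
theorem state_star_algLin_star_algLin (t : ℕ) (r₁ r₂ r₃ r₄ : ℕ → ℂ) :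
    ω (star (algLin t r₁) * (algLin t r₂ * (star (algLin t r₃) * algLin t r₄)))
      = (σ : ℂ) ^ 2 * (gram t r₁ r₂ * gram t r₃ r₄)
        + σ * (1 - σ) * (gram t r₃ r₂ * gram t r₁ r₄) := by
  rw [← mul_assoc (algLin t r₂), algLin_mul_star, sub_mul, mul_sub, map_sub, smul_mul_assoc,
    one_mul, mul_smul_comm, map_smul, state_star_algLin_algLin hq, mul_assoc (star (algLin t r₃)),
    state_star_star_algLin_algLin hq, smul_eq_mul]
  ring

end Monomials

end QuasiFree

/-! ### The product state -/

section Product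

variable {d : ℕ}

/-- `B ⊗ A` as an element of `𝓑 ⊗ 𝓐`. -/
def algTens (B : resAlg) (A : SampleOp d) : Matrix (Finset (Fin d)) (Finset (Fin d)) resAlg :=
  Matrix.of fun I J => A I J • B

theorem algTens_mul (B B' : resAlg) (A A' : SampleOp d) :
    algTens B A * algTens B' A' = algTens (B * B') (A * A') := by
  ext1 I J
  simp only [Matrix.mul_apply, algTens, Matrix.of_apply, smul_mul_smul_comm, Finset.sum_smul]

theorem algTens_conjTranspose (B : resAlg) (A : SampleOp d) :
    (algTens B A)ᴴ = algTens (star B) Aᴴ := by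
  ext1 I J
  simp only [Matrix.conjTranspose_apply, algTens, Matrix.of_apply, star_smul]

theorem map_algTens (B : resAlg) (A : SampleOp d) :
    (algTens B A).map Subtype.val = tens (B : ResFock →L[ℂ] ResFock) A := rfl

theorem prodState_add (ω : resAlg →ₗ[ℂ] ℂ) (ρ : SampleOp d)
    (X Y : Matrix (Finset (Fin d)) (Finset (Fin d)) resAlg) :
    prodState ω ρ (X + Y) = prodState ω ρ X + prodState ω ρ Y := by
  rw [prodState, Matrix.map_add _ (map_add ω), mul_add, Matrix.trace_add]
  rfl

theorem prodState_sub (ω : resAlg →ₗ[ℂ] ℂ) (ρ : SampleOp d)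
    (X Y : Matrix (Finset (Fin d)) (Finset (Fin d)) resAlg) :
    prodState ω ρ (X - Y) = prodState ω ρ X - prodState ω ρ Y := by
  rw [prodState, Matrix.map_sub _ (map_sub ω), mul_sub, Matrix.trace_sub]
  rfl

theorem prodState_algTens (ω : resAlg →ₗ[ℂ] ℂ) (ρ : SampleOp d) (B : resAlg) (A : SampleOp d) :
    prodState ω ρ (algTens B A) = ω B * (ρ * A).trace := by
  have : (algTens B A).map ω = ω B • A := by
    ext1 I J
    simp [algTens, mul_comm]
  rw [prodState, this, mul_smul_comm, Matrix.trace_smul, smul_eq_mul]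

variable {σ : ℝ} {ω : resAlg →ₗ[ℂ] ℂ}

theorem prodState_two (hω : ω 1 = 1) (hq : IsQuasiFree ((σ : ℂ) • (1 : Matrix ℤ ℤ ℂ)) ω)
    {ρ : SampleOp d} (hρ : ρ.trace = 1) (A₁ A₂ : SampleOp d) (t : ℕ) (r₁ r₂ : ℕ → ℂ) :
    prodState ω ρ ((algTens 1 A₁ + algTens (algLin t r₁) 1)ᴴ
        * (algTens 1 A₂ + algTens (algLin t r₂) 1))
      = (ρ * (A₁ᴴ * A₂)).trace + σ * gram t r₁ r₂ := by
  simp only [Matrix.conjTranspose_add, algTens_conjTranspose, add_mul, mul_add, algTens_mul,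
    prodState_add, prodState_algTens, star_one, one_mul, mul_one, Matrix.conjTranspose_one,
    state_algLin hq, state_star_algLin hq, state_star_algLin_algLin hq, hω, hρ]
  ring

/-- Of the sixteen terms, those with an odd number of reservoir factors and the two with only two
creators or only two annihilators have zero expectation. The rest carry no signs, since sample and
reservoir factors commute. -/
theorem prodState_four (hω : ω 1 = 1) (hq : IsQuasiFree ((σ : ℂ) • (1 : Matrix ℤ ℤ ℂ)) ω)
    {ρ : SampleOp d} (hρ : ρ.trace = 1) (A₁ A₂ A₃ A₄ : SampleOp d) (t : ℕ)
    (r₁ r₂ r₃ r₄ : ℕ → ℂ) :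
    prodState ω ρ ((algTens 1 A₁ + algTens (algLin t r₁) 1)ᴴ
        * (algTens 1 A₂ + algTens (algLin t r₂) 1)
        * ((algTens 1 A₃ + algTens (algLin t r₃) 1)ᴴ
        * (algTens 1 A₄ + algTens (algLin t r₄) 1)))
      = (ρ * (A₁ᴴ * (A₂ * (A₃ᴴ * A₄)))).trace + σ * gram t r₁ r₂ * (ρ * (A₃ᴴ * A₄)).trace
        + σ * gram t r₁ r₄ * (ρ * (A₂ * A₃ᴴ)).trace
        + (1 - σ) * gram t r₃ r₂ * (ρ * (A₁ᴴ * A₄)).trace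
        + σ * gram t r₃ r₄ * (ρ * (A₁ᴴ * A₂)).trace
        + (σ ^ 2 * (gram t r₁ r₂ * gram t r₃ r₄)
          + σ * (1 - σ) * (gram t r₃ r₂ * gram t r₁ r₄)) := by
  simp only [Matrix.conjTranspose_add, algTens_conjTranspose, add_mul, mul_add, algTens_mul,
    prodState_add, prodState_algTens, star_one, one_mul, mul_one, Matrix.conjTranspose_one,
    mul_assoc, state_algLin hq, state_star_algLin hq, state_star_algLin_algLin hq,
    state_algLin_algLin hq, state_star_star hq, state_algLin_star hq hω,
    state_star_algLin_algLin_algLin hq, state_star_star_algLin hq, state_star_algLin_star hq,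
    state_algLin_star_algLin hq, state_star_algLin_star_algLin hq, hω, hρ]
  ring

theorem map_val_mul (X Y : Matrix (Finset (Fin d)) (Finset (Fin d)) resAlg) :
    (X * Y).map Subtype.val = X.map Subtype.val * Y.map Subtype.val :=
  Matrix.map_mul (f := resAlg.subtype)

theorem map_val_injective :
    Function.Injective fun X : Matrix (Finset (Fin d)) (Finset (Fin d)) resAlg =>
      X.map Subtype.val := by
  intro X Y h
  ext1 I J
  exact Subtype.ext (congrFun (congrFun h I) J)

end Product

/-! ### Expectations at time `t` -/

section Expect

variable {d : ℕ} [NeZero d]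

/-- The evolved annihilation operator as an element of `𝓑 ⊗ 𝓐`. -/
def evolAnn (W : Matrix (Fin d) (Fin d) ℂ) (α : ℝ) (t : ℕ) (j : Fin d) :
    Matrix (Finset (Fin d)) (Finset (Fin d)) resAlg :=
  algTens 1 (sampleLin ((damped W α ^ t) j)) + algTens (algLin t (resCoef W α j t)) 1

theorem map_evolAnn {W : Matrix (Fin d) (Fin d) ℂ} (hW : Wᴴ * W = 1) (α : ℝ) (t : ℕ)
    (j : Fin d) : (evolAnn W α t j).map Subtype.val
      = (linStep W α)^[t] (tens 1 (sampleAnn j)) := by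
  rw [linStep_iterate hW, evolAnn, Matrix.map_add _ (fun _ _ => rfl), map_algTens, map_algTens,
    coe_algLin]
  rfl

theorem map_evolObs (W : Matrix (Fin d) (Fin d) ℂ) (α : ℝ) (t : ℕ) (A : SampleOp d) :
    (evolObs W α t A).map Subtype.val = evol W α t (tens 1 A) := rfl

theorem evolObs_pair {W : Matrix (Fin d) (Fin d) ℂ} (hW : Wᴴ * W = 1) (α : ℝ) (t : ℕ)
    (i j : Fin d) : evolObs W α t ((sampleAnn i)ᴴ * sampleAnn j)
      = (evolAnn W α t i)ᴴ * evolAnn W α t j := by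
  apply map_val_injective
  have h : ((evolAnn W α t i)ᴴ).map Subtype.val = ((evolAnn W α t i).map Subtype.val)ᴴ := rfl
  have h2 : tens 1 ((sampleAnn i)ᴴ * sampleAnn j)
      = (tens 1 (sampleAnn i))ᴴ * tens 1 (sampleAnn j) := by
    rw [tens_conjTranspose, tens_mul, star_one, one_mul]
  simp only []
  rw [map_evolObs, map_val_mul, h, map_evolAnn hW, map_evolAnn hW, h2, evol_conjTranspose_mul hW]

theorem evolObs_mul {W : Matrix (Fin d) (Fin d) ℂ} (hW : Wᴴ * W = 1) (α : ℝ) (t : ℕ)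
    (A A' : SampleOp d) : evolObs W α t (A * A') = evolObs W α t A * evolObs W α t A' := by
  apply map_val_injective
  simp only []
  rw [map_val_mul, map_evolObs, map_evolObs, map_evolObs, ← evol_mul hW, tens_mul, one_mul]

theorem evolObs_sub (W : Matrix (Fin d) (Fin d) ℂ) (α : ℝ) (t : ℕ)
    (A A' : SampleOp d) : evolObs W α t (A - A') = evolObs W α t A - evolObs W α t A' := by
  apply map_val_injective
  simp only []
  rw [Matrix.map_sub _ (fun _ _ => rfl), map_evolObs, map_evolObs, map_evolObs]
  have : tens 1 (A - A') = tens 1 A - tens 1 A' := by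
    rw [sub_eq_add_neg, tens_add_right, ← neg_one_smul ℂ A', tens_smul_right, neg_one_smul,
      ← sub_eq_add_neg]
  rw [this]
  simp only [evol, mul_sub, sub_mul]

end Expect

/-! ### Decay of the damped walk -/

/-- Gelfand's formula: for $r$ strictly between the spectral radius and $1$, eventually $\|a^n\|\le
r^n$. -/
theorem tendsto_pow_zero_of_spectralRadius_lt_one {A : Type*} [NormedRing A] [NormedAlgebra ℂ A]
    [CompleteSpace A] {a : A} (h : spectralRadius ℂ a < 1) :
    Tendsto (fun n : ℕ => a ^ n) atTop (𝓝 0) := by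
  obtain ⟨r, hr, hr1⟩ := ENNReal.lt_iff_exists_nnreal_btwn.1 h
  have hr1' : r < 1 := by exact_mod_cast hr1
  have hev := (spectrum.pow_nnnorm_pow_one_div_tendsto_nhds_spectralRadius a).eventually_lt_const hr
  refine squeeze_zero_norm' (a := fun n : ℕ => (r : ℝ) ^ n) ?_
    (tendsto_pow_atTop_nhds_zero_of_lt_one r.2 (by exact_mod_cast hr1'))
  filter_upwards [hev, eventually_gt_atTop 0] with n hn hn0
  have hn' : (0 : ℝ) < n := by exact_mod_cast hn0
  have h1 : ((‖a ^ n‖₊ : ENNReal) ^ (1 / n : ℝ)) ^ (n : ℝ) ≤ (r : ENNReal) ^ (n : ℝ) :=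
    ENNReal.rpow_le_rpow hn.le hn'.le
  rw [← ENNReal.rpow_mul, one_div_mul_cancel hn'.ne', ENNReal.rpow_one, ENNReal.rpow_natCast] at h1
  have h2 : ‖a ^ n‖₊ ≤ r ^ n := by exact_mod_cast h1
  exact_mod_cast h2

section Decay

variable {d : ℕ}

theorem dotProduct_star_self_eq (v : Fin d → ℂ) :
    star v ⬝ᵥ v = ((∑ k, ‖v k‖ ^ 2 : ℝ) : ℂ) := by
  rw [dotProduct, Complex.ofReal_sum]
  refine Finset.sum_congr rfl fun k _ => ?_
  rw [Pi.star_apply, RCLike.star_def, Complex.conj_mul']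
  push_cast
  rfl

theorem sum_norm_sq_mulVec {W : Matrix (Fin d) (Fin d) ℂ} (hW : Wᴴ * W = 1) (v : Fin d → ℂ) :
    ∑ k, ‖(W *ᵥ v) k‖ ^ 2 = ∑ k, ‖v k‖ ^ 2 := by
  have h : star (W *ᵥ v) ⬝ᵥ (W *ᵥ v) = star v ⬝ᵥ v := by
    rw [Matrix.star_mulVec, Matrix.dotProduct_mulVec, Matrix.vecMul_vecMul, hW, Matrix.vecMul_one]
  rw [dotProduct_star_self_eq, dotProduct_star_self_eq] at h
  exact_mod_cast h

variable [NeZero d]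

/-- No eigenvector of `W` vanishes at the site `0` of the coupling. -/
def NoDarkState (W : Matrix (Fin d) (Fin d) ℂ) : Prop :=
  ∀ (z : ℂ) (v : Fin d → ℂ), W *ᵥ v = z • v → v 0 = 0 → v = 0

/-- Unitarity of $W$ gives $|z|^2\|v\|^2=\|Dv\|^2=\|v\|^2-(1-\cos^2\alpha)|v_0|^2$. If $|z|\ge1$
then $v_0=0$, so $Dv=v$ and $v$ is a dark state of $W$. -/
theorem norm_lt_one_of_damped_eigenvector {W : Matrix (Fin d) (Fin d) ℂ} (hW : Wᴴ * W = 1)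
    (h : NoDarkState W) {α : ℝ} (hα : Real.cos α ^ 2 < 1) {z : ℂ} {v : Fin d → ℂ} (hv : v ≠ 0)
    (hz : damped W α *ᵥ v = z • v) : ‖z‖ < 1 := by
  by_contra! hz1
  have hD : ∀ k, ((Matrix.diagonal fun k : Fin d => if k = 0 then (Real.cos α : ℂ) else 1) *ᵥ v) k
      = (if k = 0 then (Real.cos α : ℂ) else 1) * v k := fun k => Matrix.mulVec_diagonal _ _ k
  have h1 := sum_norm_sq_mulVec hW
    ((Matrix.diagonal fun k : Fin d => if k = 0 then (Real.cos α : ℂ) else 1) *ᵥ v)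
  rw [Matrix.mulVec_mulVec] at h1
  change ∑ k, ‖(damped W α *ᵥ v) k‖ ^ 2 = _ at h1
  rw [hz] at h1
  simp only [hD, Pi.smul_apply, smul_eq_mul, norm_mul, mul_pow, ← Finset.mul_sum] at h1
  have h2 : ∑ k, ‖(if k = 0 then (Real.cos α : ℂ) else 1)‖ ^ 2 * ‖v k‖ ^ 2
      = ∑ k, ‖v k‖ ^ 2 - (1 - Real.cos α ^ 2) * ‖v 0‖ ^ 2 := by
    rw [eq_sub_iff_add_eq, ← Finset.add_sum_erase _ _ (Finset.mem_univ (0 : Fin d)),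
      ← Finset.add_sum_erase _ _ (Finset.mem_univ (0 : Fin d))]
    rw [Finset.sum_congr (g := fun k => ‖v k‖ ^ 2) rfl fun k hk => by
      rw [if_neg (Finset.ne_of_mem_erase hk), norm_one, one_pow, one_mul]]
    rw [if_pos rfl, Complex.norm_real, Real.norm_eq_abs, sq_abs]
    ring
  rw [h2] at h1
  have h3 : 0 ≤ ∑ k, ‖v k‖ ^ 2 := Finset.sum_nonneg fun k _ => by positivity
  have h4 : 1 ≤ ‖z‖ ^ 2 := one_le_pow₀ hz1
  have h5 : ‖v 0‖ ^ 2 = 0 := by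
    have : (1 - Real.cos α ^ 2) * ‖v 0‖ ^ 2 ≤ 0 := by nlinarith
    have h6 : 0 ≤ ‖v 0‖ ^ 2 := by positivity
    nlinarith
  have h0 : v 0 = 0 := by simpa using h5
  refine hv (h z v ?_ h0)
  rw [← hz, damped, ← Matrix.mulVec_mulVec]
  congr 1
  ext k
  rw [hD]
  split_ifs with hk
  · rw [hk, h0, mul_zero]
  · rw [one_mul]

-- In finite dimension the spectrum consists of eigenvalues and is compact, so the pointwise bound
-- $|z|<1$ passes to the spectral radius.
attribute [local instance] Matrix.linftyOpNormedRing Matrix.linftyOpNormedAlgebra in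
theorem tendsto_damped_pow {W : Matrix (Fin d) (Fin d) ℂ} (hW : Wᴴ * W = 1)
    (h : NoDarkState W) {α : ℝ} (hα : Real.cos α ^ 2 < 1) :
    Tendsto (fun t : ℕ => damped W α ^ t) atTop (𝓝 0) := by
  have hc : @CompleteSpace (Matrix (Fin d) (Fin d) ℂ) PseudoMetricSpace.toUniformSpace :=
    inferInstanceAs (CompleteSpace (Fin d → Fin d → ℂ))
  refine tendsto_pow_zero_of_spectralRadius_lt_one ?_
  refine spectrum.spectralRadius_lt_of_forall_lt (r := 1) _ fun z hz => ?_
  rw [← Matrix.spectrum_toLin', ← Module.End.hasEigenvalue_iff_mem_spectrum] at hz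
  obtain ⟨v, hv⟩ := hz.exists_hasEigenvector
  have hv' := hv.apply_eq_smul
  rw [Matrix.toLin'_apply] at hv'
  exact_mod_cast norm_lt_one_of_damped_eigenvector hW h hα hv.2 hv'

end Decay

/-! ### Thermalization -/

section Thermalization

variable {d : ℕ}

theorem tendsto_trace_mul {ρ : SampleOp d} {X : ℕ → SampleOp d} (h : Tendsto X atTop (𝓝 0)) :
    Tendsto (fun t => (ρ * X t).trace) atTop (𝓝 0) := by
  have h2 : Continuous fun M : SampleOp d => (ρ * M).trace := by fun_prop
  have h3 := (h2.tendsto 0).comp h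
  simpa [Function.comp_def] using h3

variable [NeZero d]

theorem tendsto_sampleLin {W : Matrix (Fin d) (Fin d) ℂ} (hW : Wᴴ * W = 1)
    (h : NoDarkState W) {α : ℝ} (hα : Real.cos α ^ 2 < 1) (j : Fin d) :
    Tendsto (fun t : ℕ => sampleLin ((damped W α ^ t) j)) atTop (𝓝 0) := by
  have h1 := tendsto_damped_pow hW h hα
  have h2 : Continuous fun M : Matrix (Fin d) (Fin d) ℂ => sampleLin (M j) := by
    unfold sampleLin
    refine continuous_finsetSum _ fun k _ => ?_
    exact (continuous_id.matrix_elem j k).smul continuous_const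
  have h3 := (h2.tendsto 0).comp h1
  have h4 : sampleLin ((0 : Matrix (Fin d) (Fin d) ℂ) j) = 0 := by simp [sampleLin]
  rwa [h4] at h3

theorem tendsto_gram {W : Matrix (Fin d) (Fin d) ℂ} (hW : Wᴴ * W = 1)
    (h : NoDarkState W) {α : ℝ} (hα : Real.cos α ^ 2 < 1) (i j : Fin d) :
    Tendsto (fun t : ℕ => gram t (resCoef W α i t) (resCoef W α j t)) atTop
      (𝓝 (if i = j then 1 else 0)) := by
  have h1 := tendsto_damped_pow hW h hα
  have h2 : Continuous fun M : Matrix (Fin d) (Fin d) ℂ => (1 - M * Mᴴ) j i :=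
    Continuous.matrix_elem (by fun_prop) j i
  have h3 := (h2.tendsto 0).comp h1
  simp only [zero_mul, sub_zero, Matrix.one_apply, eq_comm (a := j)] at h3
  refine h3.congr fun t => ?_
  exact (resGram_eq hW α t i j).symm

variable {σ : ℝ} {ω : resAlg →ₗ[ℂ] ℂ}

theorem tendsto_expect_two (hω : ω 1 = 1) (hq : IsQuasiFree ((σ : ℂ) • (1 : Matrix ℤ ℤ ℂ)) ω)
    {ρ : SampleOp d} (hρ : ρ.trace = 1) {W : Matrix (Fin d) (Fin d) ℂ} (hW : Wᴴ * W = 1)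
    (h : NoDarkState W) {α : ℝ} (hα : Real.cos α ^ 2 < 1) (i j : Fin d) :
    Tendsto (fun t => expect ω W α ρ t ((sampleAnn i)ᴴ * sampleAnn j)) atTop
      (𝓝 (if i = j then (σ : ℂ) else 0)) := by
  simp only [expect, evolObs_pair hW, evolAnn, prodState_two hω hq hρ]
  have hA := tendsto_sampleLin hW h hα
  have hX : Tendsto (fun t : ℕ => (sampleLin ((damped W α ^ t) i))ᴴ
      * sampleLin ((damped W α ^ t) j)) atTop (𝓝 0) := by
    have := ((hA i).star).mul (hA j)
    simpa [Matrix.star_eq_conjTranspose] using this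
  have := (tendsto_trace_mul (ρ := ρ) hX).add ((tendsto_gram hW h hα i j).const_mul (σ : ℂ))
  simpa using this

theorem tendsto_expect_four (hω : ω 1 = 1) (hq : IsQuasiFree ((σ : ℂ) • (1 : Matrix ℤ ℤ ℂ)) ω)
    {ρ : SampleOp d} (hρ : ρ.trace = 1) {W : Matrix (Fin d) (Fin d) ℂ} (hW : Wᴴ * W = 1)
    (h : NoDarkState W) {α : ℝ} (hα : Real.cos α ^ 2 < 1) (i j k l : Fin d) :
    Tendsto (fun t => expect ω W α ρ t
      ((sampleAnn i)ᴴ * sampleAnn j * ((sampleAnn k)ᴴ * sampleAnn l))) atTop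
      (𝓝 ((σ : ℂ) ^ 2 * ((if i = j then 1 else 0) * (if k = l then 1 else 0))
        + σ * (1 - σ) * ((if k = j then 1 else 0) * (if i = l then 1 else 0)))) := by
  have hevol : ∀ t, evolObs W α t
      ((sampleAnn i)ᴴ * sampleAnn j * ((sampleAnn k)ᴴ * sampleAnn l))
      = (evolAnn W α t i)ᴴ * evolAnn W α t j * ((evolAnn W α t k)ᴴ * evolAnn W α t l) := by
    intro t
    rw [evolObs_mul hW, evolObs_pair hW, evolObs_pair hW]
  simp only [expect, hevol, evolAnn, prodState_four hω hq hρ]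
  have hA := tendsto_sampleLin hW h hα
  have hA' : ∀ i, Tendsto (fun t : ℕ => (sampleLin ((damped W α ^ t) i))ᴴ) atTop (𝓝 0) := by
    intro i
    simpa [Matrix.star_eq_conjTranspose] using (hA i).star
  have hG := tendsto_gram hW h hα
  have h1 := tendsto_trace_mul (ρ := ρ) ((hA' i).mul ((hA j).mul ((hA' k).mul (hA l))) |>.trans
    (by simp))
  have h2 := tendsto_trace_mul (ρ := ρ) (((hA' k).mul (hA l)).trans (by simp))
  have h3 := tendsto_trace_mul (ρ := ρ) (((hA j).mul (hA' k)).trans (by simp))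
  have h4 := tendsto_trace_mul (ρ := ρ) (((hA' i).mul (hA l)).trans (by simp))
  have h5 := tendsto_trace_mul (ρ := ρ) (((hA' i).mul (hA j)).trans (by simp))
  have := ((((h1.add (((hG i j).const_mul (σ : ℂ)).mul h2)).add
    (((hG i l).const_mul (σ : ℂ)).mul h3)).add
    (((hG k j).const_mul (1 - σ : ℂ)).mul h4)).add
    (((hG k l).const_mul (σ : ℂ)).mul h5)).add
    ((((hG i j).mul (hG k l)).const_mul ((σ : ℂ) ^ 2)).add
      (((hG k j).mul (hG i l)).const_mul ((σ : ℂ) * (1 - σ))))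
  simpa using this

theorem expect_sub (ω : resAlg →ₗ[ℂ] ℂ) (W : Matrix (Fin d) (Fin d) ℂ) (α : ℝ) (ρ : SampleOp d)
    (t : ℕ) (A A' : SampleOp d) :
    expect ω W α ρ t (A - A') = expect ω W α ρ t A - expect ω W α ρ t A' := by
  rw [expect, evolObs_sub, prodState_sub]
  rfl

theorem thermalizes_of_noDarkState (hω : ω 1 = 1)
    (hq : IsQuasiFree ((σ : ℂ) • (1 : Matrix ℤ ℤ ℂ)) ω) {W : Matrix (Fin d) (Fin d) ℂ}
    (hW : Wᴴ * W = 1) (h : NoDarkState W) {α : ℝ} (hα : Real.cos α ^ 2 < 1) :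
    Thermalizes ω W α σ := by
  intro ρ hρ
  have h2 := tendsto_expect_two hω hq hρ.2 hW h hα
  have h4 := tendsto_expect_four hω hq hρ.2 hW h hα
  refine ⟨?_, ?_, fun j => ?_, fun j k hjk => ?_⟩
  · refine tendsto_pi_nhds.2 fun j => tendsto_pi_nhds.2 fun k => ?_
    have hjk : (k.1 0 = j.1 0) ↔ j = k := by
      constructor
      · intro h0
        apply Subtype.ext
        funext i
        rw [Subsingleton.elim i 0, h0]
      · rintro rfl
        rfl
    have := h2 (k.1 0) (j.1 0)
    simp only [hjk] at this
    simpa [reducedDM, Matrix.one_apply] using this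
  · refine tendsto_pi_nhds.2 fun j => tendsto_pi_nhds.2 fun k => ?_
    obtain ⟨j, hj⟩ := j
    obtain ⟨k, hk⟩ := k
    have hj' : j 0 < j 1 := hj (by decide)
    have hk' : k 0 < k 1 := hk (by decide)
    -- The time evolution is explicit on products of pairs $a^*a$, so the two-body observable is
    -- brought to that shape, at the price of a one-body term.
    have hcomm : (sampleAnn (k 0))ᴴ * (sampleAnn (k 1))ᴴ * (sampleAnn (j 1) * sampleAnn (j 0))
        = (sampleAnn (k 0))ᴴ * sampleAnn (j 0) * ((sampleAnn (k 1))ᴴ * sampleAnn (j 1))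
          - if j 0 = k 1 then (sampleAnn (k 0))ᴴ * sampleAnn (j 1) else 0 := by
      have e1 := eq_neg_of_add_eq_zero_left (sampleAnn_anticomm (j 1) (j 0))
      have e2 := eq_sub_of_add_eq (sampleAnn_car (j 0) (k 1))
      rw [e1, mul_assoc _ (sampleAnn (j 0)), ← mul_assoc (sampleAnn (j 0)), e2]
      split_ifs
      · noncomm_ring
      · noncomm_ring
    have hexp : ∀ t, reducedDM 2 ω W α ρ t ⟨j, hj⟩ ⟨k, hk⟩
        = expect ω W α ρ t
          ((sampleAnn (k 0))ᴴ * sampleAnn (j 0) * ((sampleAnn (k 1))ᴴ * sampleAnn (j 1)))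
          - (if j 0 = k 1 then expect ω W α ρ t ((sampleAnn (k 0))ᴴ * sampleAnn (j 1)) else 0) := by
      intro t
      have : reducedDM 2 ω W α ρ t ⟨j, hj⟩ ⟨k, hk⟩ = expect ω W α ρ t
          ((sampleAnn (k 0))ᴴ * (sampleAnn (k 1))ᴴ * (sampleAnn (j 1) * sampleAnn (j 0))) := by
        simp [reducedDM]
      rw [this, hcomm]
      split_ifs
      · rw [expect_sub]
      · rw [sub_zero, sub_zero]
    simp only [hexp]
    have hlim := h4 (k 0) (j 0) (k 1) (j 1)
    -- Both index pairs are increasing, so they cannot be exchanged copies of each other; this kills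
    -- the exchange term of Wick's formula and the limit of the one-body correction.
    have hne : ¬ (k 1 = j 0 ∧ k 0 = j 1) := by
      rintro ⟨e1, e2⟩
      exact lt_asymm hk' (by rw [e1, e2]; exact hj')
    have heq : ((⟨j, hj⟩ : {j : Fin 2 → Fin d // StrictMono j}) = ⟨k, hk⟩)
        ↔ (k 0 = j 0 ∧ k 1 = j 1) := by
      rw [Subtype.mk.injEq]
      constructor
      · rintro rfl
        exact ⟨rfl, rfl⟩
      · rintro ⟨e1, e2⟩
        funext i
        fin_cases i
        · exact e1.symm
        · exact e2.symm
    have hlim2 : Tendsto (fun t => if j 0 = k 1 then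
        expect ω W α ρ t ((sampleAnn (k 0))ᴴ * sampleAnn (j 1)) else 0) atTop (𝓝 0) := by
      split_ifs with h0
      · have := h2 (k 0) (j 1)
        rwa [if_neg fun e => hne ⟨h0.symm, e⟩] at this
      · exact tendsto_const_nhds
    have := hlim.sub hlim2
    convert this using 2
    rw [Matrix.smul_apply, Matrix.one_apply]
    have hz : (if k 1 = j 0 then (1 : ℂ) else 0) * (if k 0 = j 1 then 1 else 0) = 0 := by
      split_ifs with a b
      · exact absurd ⟨a, b⟩ hne
      all_goals simp
    rw [hz, mul_zero, add_zero, sub_zero, smul_eq_mul, if_congr heq rfl rfl, ite_and, ite_mul,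
      one_mul, zero_mul]
  · simpa [sampleNum] using h2 j j
  · have := h4 j j k k
    simpa [sampleNum, hjk, hjk.symm] using this

end Thermalization

/-! ### Unitarity and cyclicity of the walks -/

section Walks

/-- Since $W$ is unitary, $v^*$ is a left eigenvector, so $v^*W^ke_0$ is a multiple of
$\overline{v_0}=0$ for every $k$. Thus $v$ is orthogonal to the Krylov space of $e_0$, which is
everything. -/
theorem noDarkState_of_cyclicZero {d : ℕ} [NeZero d] {W : Matrix (Fin d) (Fin d) ℂ}
    (hW : Wᴴ * W = 1) (h : CyclicZero W) : NoDarkState W := by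
  intro z v hv h0
  rcases eq_or_ne z 0 with rfl | hz
  · rw [zero_smul] at hv
    rw [← Matrix.one_mulVec v, ← hW, ← Matrix.mulVec_mulVec, hv, Matrix.mulVec_zero]
  have h1 : Wᴴ *ᵥ v = z⁻¹ • v := by
    rw [← inv_smul_smul₀ hz (Wᴴ *ᵥ v), ← Matrix.mulVec_smul, ← hv, Matrix.mulVec_mulVec, hW,
      Matrix.one_mulVec]
  have h2 : star v ᵥ* W = star z⁻¹ • star v := by
    rw [← star_smul, ← h1, Matrix.star_mulVec, Matrix.conjTranspose_conjTranspose]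
  have h3 : ∀ k : ℕ, star v ᵥ* W ^ k = (star z⁻¹) ^ k • star v := by
    intro k
    induction k with
    | zero => simp
    | succ k ih => rw [pow_succ, ← Matrix.vecMul_vecMul, ih, Matrix.smul_vecMul, h2, smul_smul,
        pow_succ]
  have h4 : Submodule.span ℂ (Set.range fun k : ℕ => (W ^ k) *ᵥ (Pi.single (0 : Fin d) (1 : ℂ)))
      ≤ LinearMap.ker (dotProductBilin ℂ ℂ (star v)) := by
    rw [Submodule.span_le]
    rintro _ ⟨k, rfl⟩
    simp only [SetLike.mem_coe, LinearMap.mem_ker, dotProductBilin_apply_apply]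
    rw [Matrix.dotProduct_mulVec, h3, smul_dotProduct]
    simp [h0]
  have h5 : v ∈ LinearMap.ker (dotProductBilin ℂ ℂ (star v)) := h4 (by rw [h]; trivial)
  exact dotProduct_star_self_eq_zero.1 (by simpa using h5)

/-! ### Matrix entries and unitarity of the walk on the circle. -/

section Circle

variable {n : ℕ} [NeZero n]

theorem circleWalk_apply (C : Fin n → Coin) (y x : Fin n) (s r : Fin 2) :
    circleWalk C (y, s) (x, r)
      = if y = (if s = 0 then x + 1 else x - 1) then (C x : Matrix (Fin 2) (Fin 2) ℂ) s r
        else 0 := by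
  rw [circleWalk, Matrix.sum_apply, Finset.sum_eq_single x]
  · fin_cases s
    · simp [Matrix.single_apply, Matrix.mul_apply, eq_comm]
    · simp [Matrix.single_apply, Matrix.mul_apply, eq_comm]
  · intro z _ hz
    simp [hz]
  · simp

theorem circleWalk_mulVec (C : Fin n → Coin) (v : Fin n × Fin 2 → ℂ) (x : Fin n) (s : Fin 2) :
    (circleWalk C *ᵥ v) ((if s = 0 then x + 1 else x - 1), s)
      = ∑ r, (C x : Matrix (Fin 2) (Fin 2) ℂ) s r * v (x, r) := by
  rw [Matrix.mulVec, dotProduct, Fintype.sum_prod_type, Finset.sum_eq_single x]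
  · simp [circleWalk_apply]
  · intro z _ hz
    refine Finset.sum_eq_zero fun r _ => ?_
    rw [circleWalk_apply, if_neg, zero_mul]
    split_ifs
    · simpa using hz.symm
    · simpa using hz.symm
  · simp

theorem coin_unitary (c : Coin) (r r' : Fin 2) :
    ∑ s, star ((c : Matrix (Fin 2) (Fin 2) ℂ) s r) * (c : Matrix (Fin 2) (Fin 2) ℂ) s r'
      = if r = r' then 1 else 0 := by
  have := congrFun (congrFun (Matrix.mem_unitaryGroup_iff'.1 c.2) r) r'
  simpa [Matrix.mul_apply, Matrix.one_apply, Matrix.star_apply] using this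

theorem circleWalk_unitary (C : Fin n → Coin) : (circleWalk C)ᴴ * circleWalk C = 1 := by
  ext ⟨x, r⟩ ⟨x', r'⟩
  rw [Matrix.mul_apply, Fintype.sum_prod_type_right]
  have h : ∀ s : Fin 2, ∑ y, (circleWalk C)ᴴ (x, r) (y, s) * circleWalk C (y, s) (x', r')
      = if x = x' then star ((C x : Matrix (Fin 2) (Fin 2) ℂ) s r)
        * (C x : Matrix (Fin 2) (Fin 2) ℂ) s r' else 0 := by
    intro s
    rw [Finset.sum_eq_single (if s = 0 then x + 1 else x - 1)]
    · simp only [Matrix.conjTranspose_apply, circleWalk_apply, if_true]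
      have : ((if s = 0 then x + 1 else x - 1) = if s = 0 then x' + 1 else x' - 1) ↔ x = x' := by
        split_ifs <;> simp
      simp only [this]
      split_ifs with h
      · rw [h]
      · rw [mul_zero]
    · intro y _ hy
      rw [Matrix.conjTranspose_apply, circleWalk_apply, if_neg hy, star_zero, zero_mul]
    · simp
  simp only [h]
  by_cases hx : x = x'
  · subst hx
    simp only [if_true, coin_unitary, Matrix.one_apply, Prod.mk.injEq, true_and]
  · simp [hx]

theorem periodicWalk_unitary (C : Fin n → Coin) : (periodicWalk C)ᴴ * periodicWalk C = 1 := by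
  rw [periodicWalk, Matrix.conjTranspose_reindex, Matrix.reindex_apply, Matrix.reindex_apply,
    Matrix.submatrix_mul_equiv, circleWalk_unitary, Matrix.submatrix_one_equiv]

end Circle

/-! ### The Dirichlet walk: unitarity and absence of dark states. -/

section Dirichlet

variable {m : ℕ}

/-- The inclusion of the basis of the Dirichlet walk into that of the periodic walk. -/
def dirichletEmb (m : ℕ) (j : Fin (m * 2 + 2)) : Fin ((m + 2) * 2) := ⟨j.1 + 1, by omega⟩

theorem dirichletEmb_injective : Function.Injective (dirichletEmb m) := by
  intro i j h
  have := congrArg Fin.val h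
  simp only [dirichletEmb] at this
  exact Fin.ext (by omega)

theorem notMem_range_dirichletEmb {i : Fin ((m + 2) * 2)} (hi : i ∉ Set.range (dirichletEmb m)) :
    i = finProdFinEquiv ((0 : Fin (m + 2)), (0 : Fin 2))
      ∨ i = finProdFinEquiv (Fin.last (m + 1), (1 : Fin 2)) := by
  by_contra! h
  obtain ⟨h1, h2⟩ := h
  have h1' : i.1 ≠ 0 := fun h => h1 (Fin.ext (by simp [h]))
  have h2' : i.1 ≠ 2 * m + 3 := fun h => h2 (Fin.ext (by simp [h]; omega))
  exact hi ⟨⟨i.1 - 1, by omega⟩, Fin.ext (by simp only [dirichletEmb]; omega)⟩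

theorem periodicWalk_apply {n : ℕ} [NeZero n] (C : Fin n → Coin) (p q : Fin n × Fin 2) :
    periodicWalk C (finProdFinEquiv p) (finProdFinEquiv q) = circleWalk C p q := by
  simp [periodicWalk]

theorem dirichletCoins_zero (C : Fin m → Coin) : dirichletCoins C 0 = swapCoin := by
  simp [dirichletCoins]

theorem dirichletCoins_last (C : Fin m → Coin) :
    dirichletCoins C (Fin.last (m + 1)) = swapCoin := by
  simp [dirichletCoins]

/-- The two removed vectors feed only each other: $|{+1},0\rangle$ is reached from the last site
with outgoing spin $+1$, which the exchange coin produces only from incoming spin $-1$, and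
symmetrically at the other end. This lets unitarity pass to the restriction. -/
theorem periodicWalk_dirichlet_eq_zero (C : Fin m → Coin) {i : Fin ((m + 2) * 2)}
    (hi : i ∉ Set.range (dirichletEmb m)) (j : Fin (m * 2 + 2)) :
    periodicWalk (dirichletCoins C) i (dirichletEmb m j) = 0 := by
  obtain ⟨⟨x, r⟩, hq⟩ := finProdFinEquiv.surjective (dirichletEmb m j)
  have hv : r.1 + 2 * x.1 = j.1 + 1 := by
    have := congrArg Fin.val hq
    simpa [dirichletEmb] using this
  have hr := r.2
  rcases notMem_range_dirichletEmb hi with rfl | rfl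
  · rw [← hq, periodicWalk_apply, circleWalk_apply]
    simp only [if_true]
    split_ifs with h
    · have hx : x = Fin.last (m + 1) := by
        have : x + 1 = Fin.last (m + 1) + 1 := by rw [← h]; simp
        exact add_right_cancel this
      subst hx
      have hr0 : r = 0 := Fin.ext (by simp at hv ⊢; omega)
      rw [dirichletCoins_last, hr0]
      simp [swapCoin]
    · rfl
  · rw [← hq, periodicWalk_apply, circleWalk_apply]
    simp only [one_ne_zero, if_false]
    split_ifs with h
    · have hx : x = 0 := by
        have : x = Fin.last (m + 1) + 1 := by rw [h]; simp
        simpa using this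
      subst hx
      have hr0 : r = 1 := Fin.ext (by simp at hv ⊢; omega)
      rw [dirichletCoins_zero, hr0]
      simp [swapCoin]
    · rfl

theorem dirichletWalk_unitary (C : Fin m → Coin) : (dirichletWalk C)ᴴ * dirichletWalk C = 1 := by
  ext i j
  have h := congrFun (congrFun (periodicWalk_unitary (dirichletCoins C)) (dirichletEmb m i))
    (dirichletEmb m j)
  rw [Matrix.one_apply, Matrix.mul_apply] at h
  rw [Matrix.one_apply, ← if_congr dirichletEmb_injective.eq_iff rfl rfl, ← h, Matrix.mul_apply]
  refine Fintype.sum_of_injective (dirichletEmb m) dirichletEmb_injective _ _ ?_ fun k => rfl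
  intro k hk
  rw [periodicWalk_dirichlet_eq_zero C hk, mul_zero]

/-- The rows are orthogonal: if $\delta=0$ while $\alpha\neq0$, then $\gamma=0$ as well and the
second row would vanish. -/
theorem coin_diag_ne_zero {c : Coin} (h : (c : Matrix (Fin 2) (Fin 2) ℂ) 0 0 ≠ 0) :
    (c : Matrix (Fin 2) (Fin 2) ℂ) 1 1 ≠ 0 := by
  intro h1
  have e := coin_unitary c⁻¹ 0 1
  have e1 := coin_unitary c⁻¹ 1 1
  simp [Fin.sum_univ_two, h1, h, Matrix.star_apply] at e e1
  rw [e] at e1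
  simp at e1

/-- Zeros propagate to the right. If the eigenvector vanishes at site $x$, the spin $+1$ equation
arriving at $x+1$ gives $w(x+1,+1)=0$. The spin $-1$ equation arriving at $x$ then reads
$0=\delta_{x+1}w(x+1,-1)$, and $\delta_{x+1}\ne0$ because $\alpha_{x+1}\ne0$. -/
theorem dirichletWalk_noDarkState {C : Fin m → Coin}
    (hC : ∀ x, (C x : Matrix (Fin 2) (Fin 2) ℂ) 0 0 ≠ 0) : NoDarkState (dirichletWalk C) := by
  intro z v hv h0
  rcases eq_or_ne z 0 with rfl | hz
  · rw [zero_smul] at hv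
    rw [← Matrix.one_mulVec v, ← dirichletWalk_unitary C, ← Matrix.mulVec_mulVec, hv,
      Matrix.mulVec_zero]
  -- Extension by zero to the full circle, where it is still an eigenvector since no amplitude leaks
  -- into the removed vectors.
  set u : Fin ((m + 2) * 2) → ℂ := Function.extend (dirichletEmb m) v 0 with hu
  have hu1 : ∀ j, u (dirichletEmb m j) = v j := fun j => dirichletEmb_injective.extend_apply v 0 j
  have hu2 : ∀ i, i ∉ Set.range (dirichletEmb m) → u i = 0 := fun i hi =>
    Function.extend_apply' _ _ _ fun ⟨j, hj⟩ => hi ⟨j, hj⟩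
  have hmul : ∀ i, (periodicWalk (dirichletCoins C) *ᵥ u) i
      = ∑ j, periodicWalk (dirichletCoins C) i (dirichletEmb m j) * v j := by
    intro i
    refine (Fintype.sum_of_injective (dirichletEmb m) dirichletEmb_injective _ _ ?_ ?_).symm
    · intro k hk
      rw [hu2 k hk, mul_zero]
    · intro j
      rw [hu1]
  have hNu : periodicWalk (dirichletCoins C) *ᵥ u = z • u := by
    ext i
    rw [hmul]
    by_cases hi : i ∈ Set.range (dirichletEmb m)
    · obtain ⟨k, rfl⟩ := hi
      rw [Pi.smul_apply, hu1, ← Pi.smul_apply, ← hv]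
      rfl
    · rw [Pi.smul_apply, hu2 i hi, smul_zero]
      exact Finset.sum_eq_zero fun j _ => by rw [periodicWalk_dirichlet_eq_zero C hi, zero_mul]
  set w : Fin (m + 2) × Fin 2 → ℂ := u ∘ finProdFinEquiv with hw
  have hcw : ∀ p, (circleWalk (dirichletCoins C) *ᵥ w) p = z * w p := by
    intro p
    have := congrFun hNu (finProdFinEquiv p)
    rw [Pi.smul_apply, smul_eq_mul] at this
    rw [hw, Function.comp_apply, ← this]
    simp only [Matrix.mulVec, dotProduct]
    rw [← finProdFinEquiv.sum_comp]
    simp only [periodicWalk_apply, Function.comp_apply]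
  have hfst : w (0, 0) = 0 := hu2 _ fun ⟨j, hj⟩ => by
    have := congrArg Fin.val hj
    simp [dirichletEmb] at this
  have hlst : w (Fin.last (m + 1), 1) = 0 := hu2 _ fun ⟨j, hj⟩ => by
    have := congrArg Fin.val hj
    simp [dirichletEmb] at this
    omega
  have hsnd : w (0, 1) = 0 := by
    rw [← h0, ← hu1 0]
    exact congrArg u (Fin.ext (by
      simp [dirichletEmb, Nat.mod_eq_of_lt (show 1 < (m + 2) * 2 by omega)]))
  have key : ∀ x : Fin (m + 2), w (x, 0) = 0 ∧ w (x, 1) = 0 := by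
    intro x
    induction x using Fin.induction with
    | zero => exact ⟨hfst, hsnd⟩
    | succ x ih =>
      have h1 := circleWalk_mulVec (dirichletCoins C) w x.castSucc 0
      rw [hcw, Fin.sum_univ_two, ih.1, ih.2] at h1
      simp only [if_true, mul_zero, add_zero, mul_eq_zero, hz, false_or,
        Fin.coeSucc_eq_succ] at h1
      refine ⟨h1, ?_⟩
      -- At the last site the spin $-1$ vector is one of the removed ones, so its component is zero
      -- by construction.
      by_cases hx : x = Fin.last m
      · rw [hx]
        exact hlst
      · have h2 := circleWalk_mulVec (dirichletCoins C) w x.succ 1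
        have h3 : x.succ - 1 = x.castSucc := by
          rw [sub_eq_iff_eq_add, Fin.coeSucc_eq_succ]
        have hx' : x.1 < m := by
          have := x.2
          have : x.1 ≠ m := fun h => hx (Fin.ext h)
          omega
        have h4 : dirichletCoins C x.succ = C ⟨x.1, hx'⟩ := by
          simp [dirichletCoins, hx']
        rw [hcw, Fin.sum_univ_two, h1] at h2
        simp only [one_ne_zero, if_false, mul_zero, zero_add, h3, ih.2, h4] at h2
        exact (mul_eq_zero.1 h2.symm).resolve_left (coin_diag_ne_zero (hC _))
  ext j
  rw [← hu1 j]
  obtain ⟨⟨x, r⟩, hq⟩ := finProdFinEquiv.surjective (dirichletEmb m j)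
  rw [← hq]
  fin_cases r
  · exact (key x).1
  · exact (key x).2

end Dirichlet

end Walks

/-! ### Genericity of cyclic coins -/

section Generic

open MeasureTheory

theorem ae_ne_zero_of_analytic {f : ℝ → ℂ} (hf : AnalyticOnNhd ℝ f Set.univ) {θ₀ : ℝ}
    (h : f θ₀ ≠ 0) : ∀ᵐ θ : ℝ, f θ ≠ 0 := by
  rcases hf.eqOn_zero_or_eventually_ne_zero_of_preconnected isPreconnected_univ with h0 | h0
  · exact absurd (h0 (Set.mem_univ θ₀)) h
  · have := ae_restrict_le_codiscreteWithin (μ := (volume : Measure ℝ)) MeasurableSet.univ h0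
    rwa [Measure.restrict_univ] at this

/-! ### Zero sets of functions analytic along curves in a topological group. -/

section Group

variable {G : Type*} [Group G] [TopologicalSpace G] [IsTopologicalGroup G] {f : G → ℂ}

/-- Along $\theta\mapsto\gamma(\theta)x$ the function is analytic and nonzero at $\theta=1$, hence
nonzero for almost every $\theta$, in particular for some $\theta$ so close to $0$ that
$\gamma(\theta)x$ is still near $x$. -/
theorem dense_ne_zero_of_analytic_curves
    (hγ : ∀ x, ∃ γ : ℝ → G, Continuous γ ∧ γ 0 = 1 ∧ f (γ 1 * x) ≠ 0 ∧
      ∀ y, AnalyticOnNhd ℝ (fun θ => f (γ θ * y)) Set.univ) :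
    Dense {x | f x ≠ 0} := by
  intro x
  obtain ⟨γ, hc, h0, h1, ha⟩ := hγ x
  rw [mem_closure_iff]
  intro o ho hx
  have hO : IsOpen ((fun θ => γ θ * x) ⁻¹' o) := ho.preimage (by fun_prop)
  have hpos : 0 < volume ((fun θ => γ θ * x) ⁻¹' o) :=
    hO.measure_pos volume ⟨0, by simpa [h0] using hx⟩
  obtain ⟨θ, hθ1, hθ2⟩ := ((frequently_ae_mem_iff.2 hpos.ne').and_eventually
    (ae_ne_zero_of_analytic (ha x) h1)).exists
  exact ⟨_, hθ1, hθ2⟩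

/-- The curve depends on $x$, so the argument is local. For each $y$ with $f(\gamma(1)y)\ne0$,
almost every $\theta$ satisfies $f(\gamma(\theta)y)\neq0$. Fubini turns this into a null set of $y$
for almost every fixed $\theta$, and left translation by $\gamma(\theta)$ carries it to the zeros of
$f$ near $x$. -/
theorem measure_eq_zero_of_analytic_curves [SecondCountableTopology G] [CompactSpace G]
    [MeasurableSpace G] [BorelSpace G] (μ : Measure G) [μ.IsHaarMeasure] (hf : Continuous f)
    (hγ : ∀ x, ∃ γ : ℝ → G, Continuous γ ∧ γ 0 = 1 ∧ f (γ 1 * x) ≠ 0 ∧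
      ∀ y, AnalyticOnNhd ℝ (fun θ => f (γ θ * y)) Set.univ) :
    μ {x | f x = 0} = 0 := by
  refine measure_null_of_locally_null _ fun x _ => ?_
  obtain ⟨γ, hc, h0, h1, ha⟩ := hγ x
  have hO : IsOpen {y | f (γ 1 * y) ≠ 0} := isOpen_ne_fun (by fun_prop) continuous_const
  have hmeas : MeasurableSet {p : ℝ × G | f (γ 1 * p.2) ≠ 0 → f (γ p.1 * p.2) ≠ 0} := by
    have e : {p : ℝ × G | f (γ 1 * p.2) ≠ 0 → f (γ p.1 * p.2) ≠ 0}
        = {p : ℝ × G | f (γ 1 * p.2) = 0} ∪ {p : ℝ × G | f (γ p.1 * p.2) ≠ 0} := by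
      ext p
      simp only [Set.mem_ofPred_eq, Set.mem_union]
      tauto
    rw [e]
    exact (isClosed_eq (by fun_prop) continuous_const).measurableSet.union
      (isOpen_ne_fun (by fun_prop) continuous_const).measurableSet
  have hae : ∀ᵐ y ∂μ, ∀ᵐ θ : ℝ, f (γ 1 * y) ≠ 0 → f (γ θ * y) ≠ 0 := by
    refine Eventually.of_forall fun y => ?_
    by_cases hy : f (γ 1 * y) = 0
    · exact Eventually.of_forall fun θ h => absurd hy h
    · filter_upwards [ae_ne_zero_of_analytic (ha y) hy] with θ hθ _ using hθ
  rw [← Measure.ae_ae_comm hmeas] at hae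
  -- The translate by $\gamma(\theta)$ must still cover a neighbourhood of $x$; this is an open
  -- condition on $\theta$, valid at $\theta=0$.
  have hO2 : IsOpen {θ : ℝ | f (γ 1 * ((γ θ)⁻¹ * x)) ≠ 0} :=
    isOpen_ne_fun (by fun_prop) continuous_const
  have hpos : 0 < volume {θ : ℝ | f (γ 1 * ((γ θ)⁻¹ * x)) ≠ 0} :=
    hO2.measure_pos volume ⟨0, by simpa [h0] using h1⟩
  obtain ⟨θ, hθ1, hθ2⟩ := ((frequently_ae_mem_iff.2 hpos.ne').and_eventually hae).exists
  refine ⟨{y | f (γ 1 * ((γ θ)⁻¹ * y)) ≠ 0} ∩ {y | f y = 0}, ?_, ?_⟩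
  · rw [nhdsWithin]
    refine inter_mem_inf ?_ (mem_principal_self _)
    exact (isOpen_ne_fun (by fun_prop) continuous_const).mem_nhds hθ1
  · rw [← measure_preimage_mul μ (γ θ)]
    rw [ae_iff] at hθ2
    refine measure_mono_null (fun y hy => ?_) hθ2
    obtain ⟨hy1, hy2⟩ := hy
    simp only [Set.mem_ofPred_eq, inv_mul_cancel_left] at hy1 hy2 ⊢
    exact fun h => h hy1 hy2

end Group

/-! ### Topology of $U(2)$ and analytic curves in it. -/

instance : SecondCountableTopology Coin :=
  have : SecondCountableTopology (Matrix (Fin 2) (Fin 2) ℂ) :=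
    inferInstanceAs (SecondCountableTopology (Fin 2 → Fin 2 → ℂ))
  TopologicalSpace.Subtype.secondCountableTopology _

/-- Entries of unitary matrices have modulus at most one, so $U(2)$ is closed in a product of discs.
Compactness makes Haar measure finite, as suits the use of Fubini. -/
instance : CompactSpace Coin := by
  refine isCompact_iff_compactSpace.1 ?_
  have hK : IsCompact (Set.univ.pi fun _ : Fin 2 => Set.univ.pi fun _ : Fin 2 =>
      Metric.closedBall (0 : ℂ) 1) :=
    isCompact_univ_pi fun _ => isCompact_univ_pi fun _ => isCompact_closedBall _ _
  refine IsCompact.of_isClosed_subset (X := Matrix (Fin 2) (Fin 2) ℂ) hK ?_ ?_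
  · have : ((Matrix.unitaryGroup (Fin 2) ℂ : Submonoid _) : Set (Matrix (Fin 2) (Fin 2) ℂ))
        = {A | A * star A = 1} := by
      ext A
      exact Matrix.mem_unitaryGroup_iff
    rw [this]
    exact isClosed_eq (by fun_prop) continuous_const
  · intro A hA i _ j _
    exact mem_closedBall_zero_iff.2 (entry_norm_bound_of_unitary hA i j)

/-- The diagonal coin `diag (e^{ia}, e^{ib})`. -/
def diagCoin (a b : ℝ) : Coin :=
  ⟨Matrix.diagonal ![Complex.exp (a * Complex.I), Complex.exp (b * Complex.I)], by
    rw [Matrix.mem_unitaryGroup_iff, Matrix.star_eq_conjTranspose,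
      Matrix.diagonal_conjTranspose, Matrix.diagonal_mul_diagonal, ← Matrix.diagonal_one]
    congr 1
    funext i
    fin_cases i <;>
      simp [Complex.mul_conj, Complex.normSq_eq_norm_sq, Complex.norm_exp_ofReal_mul_I]⟩

/-- A `2 × 2` unitary matrix is unitarily diagonalizable. -/
theorem exists_eq_conj_diagCoin (g : Coin) :
    ∃ (V : Coin) (a b : ℝ), g = V * diagCoin a b * V⁻¹ := by
  obtain ⟨z, hz⟩ := Module.End.exists_eigenvalue
    (Matrix.toLin' (g : Matrix (Fin 2) (Fin 2) ℂ))
  obtain ⟨v, hv⟩ := hz.exists_hasEigenvector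
  have hv1 : (g : Matrix (Fin 2) (Fin 2) ℂ) *ᵥ v = z • v := by
    simpa using hv.apply_eq_smul
  obtain ⟨u, hu1, hu2⟩ : ∃ u : Fin 2 → ℂ, star (u 0) * u 0 + star (u 1) * u 1 = 1 ∧
      (g : Matrix (Fin 2) (Fin 2) ℂ) *ᵥ u = z • u := by
    have hN : 0 < ‖v 0‖ ^ 2 + ‖v 1‖ ^ 2 := by
      by_contra! h
      have h0 : v 0 = 0 := by
        have : ‖v 0‖ ^ 2 = 0 := by nlinarith [sq_nonneg ‖v 0‖, sq_nonneg ‖v 1‖]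
        simpa using this
      have h1 : v 1 = 0 := by
        have : ‖v 1‖ ^ 2 = 0 := by nlinarith [sq_nonneg ‖v 0‖, sq_nonneg ‖v 1‖]
        simpa using this
      refine hv.2 (funext fun i => ?_)
      fin_cases i
      · exact h0
      · exact h1
    refine ⟨(((Real.sqrt (‖v 0‖ ^ 2 + ‖v 1‖ ^ 2))⁻¹ : ℝ) : ℂ) • v, ?_, ?_⟩
    · simp only [Pi.smul_apply, smul_eq_mul, star_mul', RCLike.star_def, Complex.conj_ofReal]
      have e : ∀ c x y : ℂ, c * (starRingEnd ℂ) x * (c * x) + c * (starRingEnd ℂ) y * (c * y)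
          = c ^ 2 * ((starRingEnd ℂ) x * x + (starRingEnd ℂ) y * y) := by
        intro c x y
        ring
      rw [e, Complex.conj_mul', Complex.conj_mul', ← Complex.ofReal_pow, inv_pow,
        Real.sq_sqrt hN.le]
      exact_mod_cast inv_mul_cancel₀ hN.ne'
    · rw [Matrix.mulVec_smul, hv1, smul_comm]
  -- The unit eigenvector is completed to a unitary matrix. The conjugate $T=V^{-1}gV$ is then upper
  -- triangular, and unitarity makes it diagonal.
  let V : Coin := ⟨!![u 0, -star (u 1); u 1, star (u 0)], by
    rw [Matrix.mem_unitaryGroup_iff']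
    ext i j
    fin_cases i <;> fin_cases j <;>
      simp [Matrix.mul_apply, Fin.sum_univ_two, Matrix.star_apply] at hu1 ⊢
    · exact hu1
    · ring
    · ring
    · linear_combination hu1⟩
  set T : Coin := V⁻¹ * g * V with hT
  have hT10 : (T : Matrix (Fin 2) (Fin 2) ℂ) 1 0 = 0 := by
    have e0 := congrFun hu2 0
    have e1 := congrFun hu2 1
    simp only [Matrix.mulVec, dotProduct, Fin.sum_univ_two, Pi.smul_apply, smul_eq_mul] at e0 e1
    have : (T : Matrix (Fin 2) (Fin 2) ℂ) 1 0
        = -u 1 * ((g : Matrix (Fin 2) (Fin 2) ℂ) 0 0 * u 0 + (g : Matrix (Fin 2) (Fin 2) ℂ) 0 1 * u 1)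
          + u 0 * ((g : Matrix (Fin 2) (Fin 2) ℂ) 1 0 * u 0
            + (g : Matrix (Fin 2) (Fin 2) ℂ) 1 1 * u 1) := by
      simp [hT, V, Matrix.mul_apply, Fin.sum_univ_two, Matrix.star_apply]
      ring
    rw [this, e0, e1]
    ring
  have c0 := coin_unitary T 0 0
  have c1 := coin_unitary T 0 1
  have c2 := coin_unitary T 1 1
  simp only [Fin.sum_univ_two, hT10, star_zero, zero_mul, mul_zero, add_zero, if_true,
    zero_ne_one, if_false] at c0 c1 c2
  have hT00 : (T : Matrix (Fin 2) (Fin 2) ℂ) 0 0 ≠ 0 := by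
    intro h
    rw [h] at c0
    simp at c0
  have hT01 : (T : Matrix (Fin 2) (Fin 2) ℂ) 0 1 = 0 :=
    (mul_eq_zero.1 c1).resolve_left (by simpa using hT00)
  rw [hT01, mul_zero, zero_add] at c2
  have hnorm : ∀ x : ℂ, star x * x = 1 → Complex.exp (x.arg * Complex.I) = x := by
    intro x hx
    have h1 : ‖x‖ = 1 := by
      rw [RCLike.star_def, Complex.conj_mul'] at hx
      have : ‖x‖ ^ 2 = 1 := by exact_mod_cast hx
      nlinarith [norm_nonneg x]
    have h2 := Complex.norm_mul_exp_arg_mul_I x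
    rwa [h1, Complex.ofReal_one, one_mul] at h2
  refine ⟨V, ((T : Matrix (Fin 2) (Fin 2) ℂ) 0 0).arg, ((T : Matrix (Fin 2) (Fin 2) ℂ) 1 1).arg, ?_⟩
  have hD : diagCoin ((T : Matrix (Fin 2) (Fin 2) ℂ) 0 0).arg
      ((T : Matrix (Fin 2) (Fin 2) ℂ) 1 1).arg = T := by
    apply Subtype.ext
    ext i j
    fin_cases i <;> fin_cases j
    · simpa [diagCoin] using hnorm _ c0
    · simp [diagCoin, hT01]
    · simp [diagCoin, hT10]
    · simpa [diagCoin] using hnorm _ c2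
  rw [hD, hT]
  group

/-- Every coin is joined to the identity by an analytic curve. -/
theorem exists_analytic_curve (g : Coin) : ∃ γ : ℝ → Coin, γ 0 = 1 ∧ γ 1 = g ∧
    ∀ i j, AnalyticOnNhd ℝ (fun θ => (γ θ : Matrix (Fin 2) (Fin 2) ℂ) i j) Set.univ := by
  obtain ⟨V, a, b, rfl⟩ := exists_eq_conj_diagCoin g
  have h0 : diagCoin 0 0 = 1 := by
    apply Subtype.ext
    ext i j
    fin_cases i <;> fin_cases j <;> simp [diagCoin]
  -- The two eigenphases are scaled linearly, giving a one-parameter group through `g` at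
  -- $\theta=1$.
  refine ⟨fun θ => V * diagCoin (θ * a) (θ * b) * V⁻¹, ?_, ?_, fun i j => ?_⟩
  · simp [h0]
  · simp
  · have hexp : ∀ c : ℝ, AnalyticOnNhd ℝ (fun θ : ℝ => Complex.exp (((θ * c : ℝ) : ℂ) * Complex.I))
        Set.univ := by
      intro c θ _
      have : AnalyticAt ℝ (fun θ : ℝ => ((θ * c : ℝ) : ℂ)) θ :=
        (Complex.ofRealCLM.analyticAt _).comp (analyticAt_id.mul analyticAt_const)
      have hE : ∀ w : ℂ, AnalyticAt ℝ Complex.exp w := fun w => analyticAt_cexp.restrictScalars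
      exact (hE _).comp (this.mul analyticAt_const)
    have e : (fun θ : ℝ => ((V * diagCoin (θ * a) (θ * b) * V⁻¹ : Coin) : Matrix (Fin 2) (Fin 2) ℂ)
        i j) = fun θ : ℝ => ((V : Matrix (Fin 2) (Fin 2) ℂ) i 0
          * ((V⁻¹ : Coin) : Matrix (Fin 2) (Fin 2) ℂ) 0 j)
            * Complex.exp (((θ * a : ℝ) : ℂ) * Complex.I)
          + ((V : Matrix (Fin 2) (Fin 2) ℂ) i 1 * ((V⁻¹ : Coin) : Matrix (Fin 2) (Fin 2) ℂ) 1 j)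
            * Complex.exp (((θ * b : ℝ) : ℂ) * Complex.I) := by
      funext θ
      rw [Submonoid.coe_mul, Submonoid.coe_mul, Matrix.mul_apply, Fin.sum_univ_two]
      simp only [diagCoin, Matrix.mul_diagonal, Matrix.cons_val_zero, Matrix.cons_val_one]
      ring
    rw [e]
    exact (analyticOnNhd_const.mul (hexp a)).add (analyticOnNhd_const.mul (hexp b))

end Generic

/-! ### Cyclicity as nonvanishing of a Krylov determinant. -/

section Krylov

variable {d : ℕ} [NeZero d]

/-- The matrix whose columns are the vectors `W ^ κ(j) e_0`. -/
def krylov (κ : Fin d → ℕ) (W : Matrix (Fin d) (Fin d) ℂ) : Matrix (Fin d) (Fin d) ℂ :=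
  Matrix.of fun i j => (W ^ κ j) i 0

theorem krylov_col (κ : Fin d → ℕ) (W : Matrix (Fin d) (Fin d) ℂ) (j : Fin d) :
    (krylov κ W).col j = (W ^ κ j) *ᵥ (Pi.single (0 : Fin d) (1 : ℂ)) := by
  rw [Matrix.mulVec_single_one]
  rfl

theorem cyclicZero_of_det_krylov_ne_zero {κ : Fin d → ℕ} {W : Matrix (Fin d) (Fin d) ℂ}
    (h : (krylov κ W).det ≠ 0) : CyclicZero W := by
  have h1 : LinearIndependent ℂ (krylov κ W).col :=
    Matrix.linearIndependent_cols_of_isUnit ((Matrix.isUnit_iff_isUnit_det _).2 h.isUnit)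
  have h2 : Submodule.span ℂ (Set.range (krylov κ W).col) = ⊤ :=
    h1.span_eq_top_of_card_eq_finrank' (by simp)
  rw [CyclicZero, eq_top_iff, ← h2]
  refine Submodule.span_mono ?_
  rintro _ ⟨j, rfl⟩
  exact ⟨κ j, (krylov_col κ W j).symm⟩

/-- A spanning family contains a basis; its $d$ members are powers applied to $e_0$, with exponents
that need not be $0,\dots,d-1$. -/
theorem exists_det_krylov_ne_zero {W : Matrix (Fin d) (Fin d) ℂ} (h : CyclicZero W) :
    ∃ κ : Fin d → ℕ, (krylov κ W).det ≠ 0 := by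
  obtain ⟨g, hg, -, hl⟩ := Submodule.exists_fun_fin_finrank_span_eq ℂ
    (Set.range fun k : ℕ => (W ^ k) *ᵥ (Pi.single (0 : Fin d) (1 : ℂ)))
  have hd : d = Module.finrank ℂ (Submodule.span ℂ
      (Set.range fun k : ℕ => (W ^ k) *ᵥ (Pi.single (0 : Fin d) (1 : ℂ)))) := by
    rw [h, finrank_top]
    simp
  choose κ hκ using hg
  refine ⟨fun j => κ (finCongr hd j), ?_⟩
  have hcol : (krylov (fun j => κ (finCongr hd j)) W).col = g ∘ finCongr hd := by
    funext j
    rw [krylov_col]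
    exact hκ _
  have hl2 : LinearIndependent ℂ (krylov (fun j => κ (finCongr hd j)) W).col := by
    rw [hcol]
    exact hl.comp _ (finCongr hd).injective
  exact ((Matrix.isUnit_iff_isUnit_det _).1
    (Matrix.linearIndependent_cols_iff_isUnit.1 hl2)).ne_zero

end Krylov

/-! ### Genericity of cyclic coins for the periodic walk. -/

section PeriodicGeneric

variable {n : ℕ} [NeZero n]

theorem continuous_periodicWalk :
    Continuous fun C : Fin n → Coin => periodicWalk C := by
  have h : ∀ p q : Fin n × Fin 2, Continuous fun C : Fin n → Coin => circleWalk C p q := by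
    rintro ⟨y, s⟩ ⟨x, r⟩
    simp only [circleWalk_apply]
    split_ifs
    all_goals first
      | exact (continuous_subtype_val.comp (continuous_apply x)).matrix_elem s r
      | exact continuous_const
  exact continuous_matrix fun i j => h _ _

theorem continuous_det_krylov (κ : Fin (n * 2) → ℕ) :
    Continuous fun C : Fin n → Coin => (krylov κ (periodicWalk C)).det := by
  refine Continuous.matrix_det (continuous_matrix fun i j => ?_)
  exact (continuous_periodicWalk.pow (κ j)).matrix_elem i 0

/-- A curve of matrices with analytic entries. -/
def EntryAnalytic {ι κ : Type*} (M : ℝ → Matrix ι κ ℂ) : Prop :=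
  ∀ i j, AnalyticOnNhd ℝ (fun θ => M θ i j) Set.univ

theorem EntryAnalytic.mul {ι κ μ : Type*} [Fintype κ] {M : ℝ → Matrix ι κ ℂ}
    {N : ℝ → Matrix κ μ ℂ} (hM : EntryAnalytic M) (hN : EntryAnalytic N) :
    EntryAnalytic fun θ => M θ * N θ := by
  intro i j
  simp only [Matrix.mul_apply]
  exact Finset.analyticOnNhd_fun_sum _ fun k _ => (hM i k).mul (hN k j)

theorem EntryAnalytic.pow {ι : Type*} [Fintype ι] [DecidableEq ι] {M : ℝ → Matrix ι ι ℂ}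
    (hM : EntryAnalytic M) (k : ℕ) : EntryAnalytic fun θ => M θ ^ k := by
  induction k with
  | zero =>
    intro i j
    simp only [pow_zero]
    exact analyticOnNhd_const
  | succ k ih =>
    simp only [pow_succ]
    exact ih.mul hM

theorem EntryAnalytic.det {ι : Type*} [Fintype ι] [DecidableEq ι] {M : ℝ → Matrix ι ι ℂ}
    (hM : EntryAnalytic M) : AnalyticOnNhd ℝ (fun θ => (M θ).det) Set.univ := by
  simp only [Matrix.det_apply']
  exact Finset.analyticOnNhd_fun_sum _ fun s _ =>
    analyticOnNhd_const.mul (Finset.analyticOnNhd_fun_prod _ fun i _ => hM _ _)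

theorem analytic_det_krylov (κ : Fin (n * 2) → ℕ) {C : ℝ → Fin n → Coin}
    (hC : ∀ x, EntryAnalytic fun θ => (C θ x : Matrix (Fin 2) (Fin 2) ℂ)) :
    AnalyticOnNhd ℝ (fun θ => (krylov κ (periodicWalk (C θ))).det) Set.univ := by
  have h1 : EntryAnalytic fun θ => circleWalk (C θ) := by
    rintro ⟨y, s⟩ ⟨x, r⟩
    simp only [circleWalk_apply]
    by_cases h : y = if s = 0 then x + 1 else x - 1
    · simp only [if_pos h]
      exact hC x s r
    · simp only [if_neg h]
      exact analyticOnNhd_const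
  have h2 : EntryAnalytic fun θ => periodicWalk (C θ) := fun i j => h1 _ _
  exact EntryAnalytic.det fun i j => h2.pow (κ j) i 0

/-- With the exchange coin at the origin and trivial coins elsewhere, the walk permutes the
canonical basis cyclically. -/
theorem cyclicZero_single_swap :
    CyclicZero (periodicWalk (Function.update (1 : Fin n → Coin) 0 swapCoin)) := by
  obtain ⟨k, rfl⟩ := Nat.exists_eq_succ_of_ne_zero (NeZero.ne n)
  set C := Function.update (1 : Fin (k + 1) → Coin) 0 swapCoin with hC
  set W := periodicWalk C with hW
  set S := Submodule.span ℂ (Set.range fun k : ℕ => (W ^ k) *ᵥ (Pi.single 0 (1 : ℂ))) with hS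
  let e : Fin (k + 1) → Fin 2 → Fin ((k + 1) * 2) → ℂ := fun x s =>
    Pi.single (finProdFinEquiv (x, s)) 1
  have hinv : ∀ v ∈ S, W *ᵥ v ∈ S := by
    intro v hv
    induction hv using Submodule.span_induction with
    | mem v hv =>
      obtain ⟨j, rfl⟩ := hv
      exact Submodule.subset_span ⟨j + 1, by simp only [pow_succ', ← Matrix.mulVec_mulVec]⟩
    | zero => simp
    | add v w _ _ hv hw =>
      rw [Matrix.mulVec_add]
      exact S.add_mem hv hw
    | smul c v _ hv =>
      rw [Matrix.mulVec_smul]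
      exact S.smul_mem c hv
  have hstep : ∀ (x y : Fin (k + 1)) (s r : Fin 2), y = (if s = 0 then x + 1 else x - 1) →
      (∀ s', (C x : Matrix (Fin 2) (Fin 2) ℂ) s' r = if s' = s then 1 else 0) →
      W *ᵥ e x r = e y s := by
    intro x y s r hy hc
    ext i
    obtain ⟨⟨z, s'⟩, rfl⟩ := finProdFinEquiv.surjective i
    rw [Matrix.mulVec_single_one, Matrix.col_apply, hW, periodicWalk_apply, circleWalk_apply, hc]
    simp only [e, Pi.single_apply, EmbeddingLike.apply_eq_iff_eq, Prod.mk.injEq, hy]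
    by_cases hs : s' = s
    · subst hs
      simp
    · simp [hs]
  have hone : ∀ x : Fin (k + 1), x ≠ 0 → C x = 1 := fun x hx => by
    rw [hC, Function.update_of_ne hx]
    rfl
  have hzero : C 0 = swapCoin := Function.update_self _ _ _
  -- The orbit of $|{+1},0\rangle$ is followed: the exchange coin sends it to $|{-1},n-1\rangle$,
  -- which descends to $|{-1},0\rangle$. If $n>1$, a second exchange leads to $|{+1},1\rangle$,
  -- which ascends to $|{+1},n-1\rangle$.
  have h00 : e 0 0 ∈ S := Submodule.subset_span ⟨0, by
    simp only [pow_zero, Matrix.one_mulVec, e]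
    congr 1⟩
  have hlast : e (Fin.last k) 1 ∈ S := by
    rw [← hstep 0 (Fin.last k) 1 0]
    · exact hinv _ h00
    · rw [if_neg one_ne_zero, eq_sub_iff_add_eq, Fin.last_add_one]
    · intro s'
      rw [hzero]
      fin_cases s' <;> simp [swapCoin]
  have hminus : ∀ x, e x 1 ∈ S := by
    intro x
    induction x using Fin.reverseInduction with
    | last => exact hlast
    | cast x ih =>
      rw [← hstep x.succ x.castSucc 1 1]
      · exact hinv _ ih
      · rw [if_neg one_ne_zero, eq_sub_iff_add_eq, Fin.coeSucc_eq_succ]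
      · intro s'
        rw [hone _ (Fin.succ_ne_zero x)]
        simp [Matrix.one_apply]
  have hplus : ∀ x, e x 0 ∈ S := by
    intro x
    induction x using Fin.induction with
    | zero => exact h00
    | succ x ih =>
      rcases eq_or_ne x.castSucc 0 with hx | hx
      · rw [← hstep 0 x.succ 0 1]
        · exact hinv _ (hminus 0)
        · rw [if_pos rfl, ← hx, Fin.coeSucc_eq_succ]
        · intro s'
          rw [hzero]
          fin_cases s' <;> simp [swapCoin]
      · rw [← hstep x.castSucc x.succ 0 0]
        · exact hinv _ ih
        · rw [if_pos rfl, Fin.coeSucc_eq_succ]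
        · intro s'
          rw [hone _ hx]
          simp [Matrix.one_apply]
  have hall : ∀ i, (Pi.single i 1 : Fin ((k + 1) * 2) → ℂ) ∈ S := by
    intro i
    obtain ⟨⟨x, s⟩, rfl⟩ := finProdFinEquiv.surjective i
    fin_cases s
    · exact hplus x
    · exact hminus x
  rw [CyclicZero, eq_top_iff]
  intro v _
  rw [pi_eq_sum_univ' v]
  exact S.sum_mem fun i _ => S.smul_mem _ (hall i)

/-- Openness uses all exponent choices $\kappa$ at once; density and measure zero need only one
fixed $\kappa$ whose determinant is not identically zero, supplied by the permutation walk. -/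
theorem genericCoins_cyclicZero :
    GenericCoins {C : Fin n → Coin | CyclicZero (periodicWalk C)} := by
  have hunion : {C : Fin n → Coin | CyclicZero (periodicWalk C)}
      = ⋃ κ : Fin (n * 2) → ℕ, {C | (krylov κ (periodicWalk C)).det ≠ 0} := by
    ext C
    simp only [Set.mem_iUnion]
    exact ⟨exists_det_krylov_ne_zero, fun ⟨κ, h⟩ => cyclicZero_of_det_krylov_ne_zero h⟩
  obtain ⟨κ, hκ⟩ := exists_det_krylov_ne_zero (cyclicZero_single_swap (n := n))
  have hcurve : ∀ C : Fin n → Coin, ∃ γ : ℝ → Fin n → Coin, Continuous γ ∧ γ 0 = 1 ∧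
      (krylov κ (periodicWalk (γ 1 * C))).det ≠ 0 ∧ ∀ C' : Fin n → Coin, AnalyticOnNhd ℝ
        (fun θ => (krylov κ (periodicWalk (γ θ * C'))).det) Set.univ := by
    intro C
    -- The endpoint of the curve is chosen so that $\gamma(1)C$ is the permutation configuration
    -- whatever $C$ is; hence the same $\kappa$ serves for all $C$.
    choose γ h0 h1 ha using fun x => exists_analytic_curve
      ((Function.update (1 : Fin n → Coin) 0 swapCoin * C⁻¹) x)
    refine ⟨fun θ x => γ x θ, ?_, funext h0, ?_, fun C' => ?_⟩
    · refine continuous_pi fun x => Continuous.subtype_mk (f := fun θ => (γ x θ).1) ?_ _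
      exact continuous_matrix fun i j => continuousOn_univ.1 (ha x i j).continuousOn
    · have : (fun x => γ x 1) * C = Function.update (1 : Fin n → Coin) 0 swapCoin := by
        rw [funext h1, inv_mul_cancel_right]
      rw [this]
      exact hκ
    · refine analytic_det_krylov κ fun x => ?_
      have hconst : EntryAnalytic fun _ : ℝ => (C' x : Matrix (Fin 2) (Fin 2) ℂ) :=
        fun i j => analyticOnNhd_const
      exact EntryAnalytic.mul (ha x) hconst
  have hsub : {C : Fin n → Coin | (krylov κ (periodicWalk C)).det ≠ 0}
      ⊆ {C : Fin n → Coin | CyclicZero (periodicWalk C)} :=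
    fun C hC => cyclicZero_of_det_krylov_ne_zero hC
  refine ⟨?_, (dense_ne_zero_of_analytic_curves hcurve).mono hsub, ?_⟩
  · rw [hunion]
    exact isOpen_iUnion fun κ => isOpen_ne_fun (continuous_det_krylov κ) continuous_const
  · let _ : MeasurableSpace (Fin n → Coin) := borel _
    have : BorelSpace (Fin n → Coin) := ⟨rfl⟩
    intro μ hμ
    refine MeasureTheory.measure_mono_null (fun C hC => ?_)
      (measure_eq_zero_of_analytic_curves μ (continuous_det_krylov κ) hcurve)
    by_contra h
    exact hC (hsub h)

end PeriodicGeneric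

end FermiWalk

end

theorem mainTheorem3 (α σ : ℝ) (hα : Real.cos α ≠ 1 ∧ Real.cos α ≠ -1)
    (hσ : 0 ≤ σ ∧ σ ≤ 1)
    (ω : FermiWalk.resAlg →ₗ[ℂ] ℂ) (hω : FermiWalk.IsState ω)
    (hq : FermiWalk.IsQuasiFree ((σ : ℂ) • (1 : Matrix ℤ ℤ ℂ)) ω) :
    (∀ (n : ℕ) [NeZero n],
      FermiWalk.GenericCoins
        {C : Fin n → FermiWalk.Coin | FermiWalk.CyclicZero (FermiWalk.periodicWalk C)} ∧
      ∀ C : Fin n → FermiWalk.Coin, FermiWalk.CyclicZero (FermiWalk.periodicWalk C) →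
        FermiWalk.Thermalizes ω (FermiWalk.periodicWalk C) α σ) ∧
    (∀ (m : ℕ) (C : Fin m → FermiWalk.Coin),
      (∀ x : Fin m, 0 < ‖(C x : Matrix (Fin 2) (Fin 2) ℂ) 0 0
        * (C x : Matrix (Fin 2) (Fin 2) ℂ) 0 1‖) →
      FermiWalk.Thermalizes ω (FermiWalk.dirichletWalk C) α σ) := by
  have hcos : Real.cos α ^ 2 < 1 := by
    have h1 := lt_of_le_of_ne (Real.cos_le_one α) hα.1
    have h2 := lt_of_le_of_ne (Real.neg_one_le_cos α) hα.2.symm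
    nlinarith
  refine ⟨fun n _ => ⟨FermiWalk.genericCoins_cyclicZero, fun C hC => ?_⟩, fun m C hC => ?_⟩
  · have hW := FermiWalk.periodicWalk_unitary C
    exact FermiWalk.thermalizes_of_noDarkState hω.1 hq hW
      (FermiWalk.noDarkState_of_cyclicZero hW hC) hcos
  · exact FermiWalk.thermalizes_of_noDarkState hω.1 hq (FermiWalk.dirichletWalk_unitary C)
      (FermiWalk.dirichletWalk_noDarkState fun x =>
        left_ne_zero_of_mul (norm_pos_iff.1 (hC x))) hcos
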